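/- Let $\Delta=\{\zeta\in\mathbb{C}:|\zeta|<1\}$ and let $u(z,w)=-\sqrt{\log|z|\,\log|w|}$ on the punctured bidisc $\Omega=\Delta^2\setminus\{(0,0)\}$, where $u=-\infty$ on the coordinate axes $\{zw=0\}$. For $m\in\mathbb{N}$ let $\chi_m:(-\infty,0)\to(-\infty,0)$ be bounded convex non-decreasing functions such that, for every $t<0$, the sequence $\chi_m(t)$ is non-increasing in $m$ and converges to $t$. Put $u_m=\chi_m(u)$, with $\chi_m(-\infty):=\lim_{t\to-\infty}\chi_m(t)$. Then for every $m$ the current $dd^c u_m$ is positive on $\Omega$, with measure coefficients, so that the Bedford–Taylor Monge–Ampère current $(dd^c u_m)^2=dd^c(u_m\,dd^c u_m)$ is defined on $\Omega$ (with $d^c=i(\bar\partial-\partial)$); and the sequence $(dd^c u_m)^2$ does not converge weakly to $0$ on $\Omega$ as $m\to\infty$, that is, there is $\varphi\in C_c^\infty(\Omega)$ such that $\int_\Omega u_m\,dd^c\varphi\wedge dd^c u_m$ does not tend to $0$. -/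

import Mathlib

open MeasureTheory Filter Topology TopologicalSpace
open scoped Distributions

noncomputable section

/-- The Levi form `∑ a_j (conj a_k) ∂²φ/∂z_j∂z̄_k (p)` of a real function `φ` on `ℂ²`, in the
direction `a = (a_1, a_2)`. It is a quarter of the Laplacian at `ζ = 0` of the function
`ζ ↦ φ (p + ζ a)` of one complex variable. -/
def leviForm (φ : ℂ × ℂ → ℝ) (a p : ℂ × ℂ) : ℝ :=
  (fderiv ℝ (fderiv ℝ φ) p a a
    + fderiv ℝ (fderiv ℝ φ) p (Complex.I • a) (Complex.I • a)) / 4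

/-- Polarization. If `Q a = ∑ a_j (conj a_k) h_{jk}` for a Hermitian matrix `h`, then the next four
quantities are `h_{11}`, `h_{22}`, `Re h_{12}` and `Im h_{12}`. -/
def coeff11 (Q : ℂ × ℂ → ℝ) : ℝ := Q (1, 0)

/-- The coefficient `h_{22}`. -/
def coeff22 (Q : ℂ × ℂ → ℝ) : ℝ := Q (0, 1)

/-- The real part of the coefficient `h_{12}`. -/
def coeffRe12 (Q : ℂ × ℂ → ℝ) : ℝ := (Q (1, 1) - Q (1, 0) - Q (0, 1)) / 2

/-- The imaginary part of the coefficient `h_{12}`. -/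
def coeffIm12 (Q : ℂ × ℂ → ℝ) : ℝ := (Q (1, Complex.I) - Q (1, 0) - Q (0, 1)) / 2

/-- `μ` is the (positive, Radon) measure on `Ω` that represents the distribution
`∑ a_j (conj a_k) ∂²v/∂z_j∂z̄_k`. For a plurisubharmonic `v` there is exactly one for each `a`.
A measure on `Ω` is regarded as a measure on `ℂ²` that does not charge the complement of `Ω`. -/
structure IsLeviMeasure (Ω : Opens (ℂ × ℂ)) (v : ℂ × ℂ → ℝ) (a : ℂ × ℂ)
    (μ : Measure (ℂ × ℂ)) : Prop where
  measure_compl : μ (Ω : Set (ℂ × ℂ))ᶜ = 0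
  lt_top_of_isCompact : ∀ K : Set (ℂ × ℂ), K ⊆ Ω → IsCompact K → μ K < ⊤
  integral_eq : ∀ φ : 𝓓(Ω, ℝ),
    ∫ p, φ p ∂μ = ∫ p in (Ω : Set (ℂ × ℂ)), v p * leviForm φ a p

/-- The current `dd^c v` is a positive current on `Ω`, with measure coefficients. -/
def HasLeviMeasures (Ω : Opens (ℂ × ℂ)) (v : ℂ × ℂ → ℝ) : Prop :=
  ∀ a : ℂ × ℂ, ∃ μ : Measure (ℂ × ℂ), IsLeviMeasure Ω v a μ

open Classical in
/-- The measure `∑ a_j (conj a_k) ∂²v/∂z_j∂z̄_k` on `Ω` (the zero measure if there is none). -/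
def leviMeasure (Ω : Opens (ℂ × ℂ)) (v : ℂ × ℂ → ℝ) (a : ℂ × ℂ) : Measure (ℂ × ℂ) :=
  if h : ∃ μ : Measure (ℂ × ℂ), IsLeviMeasure Ω v a μ then h.choose else 0

/-- The Monge-Ampère current `(dd^c v)² = dd^c (v dd^c v)` of Bedford and Taylor, for a locally
bounded plurisubharmonic function `v` on `Ω`, as a functional on the test functions:
`⟨(dd^c v)², φ⟩ = ∫ v dd^c φ ∧ dd^c v`. With `d^c = i (∂̄ - ∂)`, that is `dd^c = 2 i ∂∂̄`,
`dd^c φ ∧ dd^c v = 16 (φ_{22} v_{11} + φ_{11} v_{22} - 2 Re (conj φ_{12} v_{12})) dV`,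
where the `v_{jk}` are measures. -/
def mongeAmpere (Ω : Opens (ℂ × ℂ)) (v : ℂ × ℂ → ℝ) (φ : 𝓓(Ω, ℝ)) : ℝ :=
  16 * (coeff11 (fun a => ∫ p, v p * coeff22 (fun b => leviForm φ b p) ∂(leviMeasure Ω v a))
    + coeff22 (fun a => ∫ p, v p * coeff11 (fun b => leviForm φ b p) ∂(leviMeasure Ω v a))
    - 2 * coeffRe12
        (fun a => ∫ p, v p * coeffRe12 (fun b => leviForm φ b p) ∂(leviMeasure Ω v a))
    - 2 * coeffIm12
        (fun a => ∫ p, v p * coeffIm12 (fun b => leviForm φ b p) ∂(leviMeasure Ω v a)))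

/-- The punctured unit bidisc `Δ² \ {(0, 0)}`. -/
def puncturedBidisc : Opens (ℂ × ℂ) where
  carrier := (Metric.ball 0 1 ×ˢ Metric.ball 0 1) \ {0}
  is_open' := (Metric.isOpen_ball.prod Metric.isOpen_ball).sdiff isClosed_singleton

/-- The function `u = -√(log |z| log |w|)`, with the value `-∞` on the coordinate axes. -/
def blockiFun (p : ℂ × ℂ) : EReal :=
  if p.1 = 0 ∨ p.2 = 0 then ⊥ else ((-√(Real.log ‖p.1‖ * Real.log ‖p.2‖) : ℝ) : EReal)

/-- A non-decreasing function `χ` on `(-∞, 0)` that is bounded below, extended to `[-∞, 0)` by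
`χ (-∞) = lim_{t → -∞} χ t = inf χ`. -/
def extendBot (χ : ℝ → ℝ) (x : EReal) : ℝ :=
  if x = ⊥ then sInf (χ '' Set.Iio 0) else χ x.toReal

end

/-! In the coordinates $x=\log|z|$, $y=\log|w|$ the function $u=-\sqrt{xy}$ is convex and
homogeneous of degree one, so its Hessian is degenerate and $(dd^c u)^2=0$ off the axes. Any mass
that survives in the limit therefore sits on the axes, and a test function has to be nonzero there
to see it. The one used is $\varphi=\alpha(\log|z|)\,B(u)$, where $\alpha\ge0$ is a bump on
$(-3,-1)$ and $B$ decreases from $1$ for $u\le-2$ to $0$ for $u\ge-1$; its support meets only the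
axis $w=0$.

For smooth $g$, convex and non-decreasing on $t<0$ and constant near $-\infty$, the function $g(u)$
is smooth on $\Omega$. The pairing can then be computed pointwise, and in the variables $(x,t)$ with
$t=u$ it factorizes (`mongeAmpere_toricExt`, `setIntegral_toricBidisc`, `integral_toricDensity`):
$$\langle(dd^c g(u))^2,\varphi\rangle=2\pi^2\int\frac{-\alpha(x)}{x}\,dx\cdot\int g'^2\,(-B')\,dt.$$

Since $g'^2\ge 2g'-1$ and $-B'\ge0$, the last factor is at least $2\int gB''+\int B'$
(`le_integral_energy`). This bound is affine in $g$ and contains no derivative of $g$, so it passes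
to limits. Each $\chi_m$ is a uniform limit of such $g$ (`exists_smooth_convex_approx`), and the
Monge-Ampère functional is continuous under uniform convergence (`tendsto_mongeAmpere`), so the
bound holds for $\chi_m$. As $\chi_m(t)\to t$ it tends to $2\int tB''+\int B'=2-1=1$. The pairings
thus stay above a sequence with the limit $2\pi^2\int-\alpha/x>0$. -/

open scoped ContDiff Convolution CompactlySupported Manifold

/-! ### Products with a factor supported in an open set -/

section Pairing

variable {E : Type*} [NormedAddCommGroup E]

/-- The functions `v` below are controlled only on `Ω`, while integrals run over the whole space. A
factor supported in `Ω` makes the product continuous everywhere. -/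
theorem continuous_mul_of_continuousOn {s : Set E} (hs : IsOpen s) {f g : E → ℝ}
    (hf : ContinuousOn f s) (hg : Continuous g) (hgs : tsupport g ⊆ s) :
    Continuous fun x => f x * g x := by
  rw [continuous_iff_continuousAt]
  intro x
  by_cases hx : x ∈ tsupport g
  · exact (hf.continuousAt (hs.mem_nhds (hgs hx))).mul hg.continuousAt
  · have h0 : (fun x => f x * g x) =ᶠ[𝓝 x] fun _ => 0 := by
      filter_upwards [notMem_tsupport_iff_eventuallyEq.1 hx] with y hy
      simp [hy]
    exact continuousAt_const.congr h0.symm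

theorem integrable_mul_of_continuousOn [MeasurableSpace E] [OpensMeasurableSpace E]
    {s : Set E} (hs : IsOpen s)
    {f g : E → ℝ} (hf : ContinuousOn f s) (hg : Continuous g) (hgs : tsupport g ⊆ s)
    (hgc : HasCompactSupport g) (μ : Measure E) [IsFiniteMeasureOnCompacts μ] :
    Integrable (fun x => f x * g x) μ :=
  (continuous_mul_of_continuousOn hs hf hg hgs).integrable_of_hasCompactSupport hgc.mul_left

end Pairing

/-! ### The Levi form: locality, linearity, integration by parts -/

theorem contDiffAt_fderiv_apply {E : Type*} [NormedAddCommGroup E] [NormedSpace ℝ E]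
    {f : E → ℝ} {x : E} (hf : ContDiffAt ℝ 2 f x) (a : E) :
    ContDiffAt ℝ 1 (fun y => fderiv ℝ f y a) x :=
  (hf.fderiv_right (m := 1) (by norm_num)).clm_apply contDiffAt_const

theorem fderiv_fderiv_apply {E : Type*} [NormedAddCommGroup E] [NormedSpace ℝ E]
    {f : E → ℝ} {x : E} (hf : ContDiffAt ℝ 2 f x) (a b : E) :
    fderiv ℝ (fun y => fderiv ℝ f y a) x b = fderiv ℝ (fderiv ℝ f) x b a := by
  have h : DifferentiableAt ℝ (fderiv ℝ f) x :=
    (hf.fderiv_right (m := 1) (by norm_num)).differentiableAt (by norm_num)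
  rw [fderiv_clm_apply h (differentiableAt_const a)]
  simp

theorem leviForm_congr {f g : ℂ × ℂ → ℝ} {p : ℂ × ℂ} (h : f =ᶠ[𝓝 p] g) (a : ℂ × ℂ) :
    leviForm f a p = leviForm g a p := by
  simp only [leviForm, (h.fderiv (𝕜 := ℝ)).fderiv_eq]

theorem continuousAt_leviForm {f : ℂ × ℂ → ℝ} {p : ℂ × ℂ} (hf : ContDiffAt ℝ 2 f p)
    (a : ℂ × ℂ) : ContinuousAt (leviForm f a) p := by
  have h : ContinuousAt (fderiv ℝ (fderiv ℝ f)) p :=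
    ((hf.fderiv_right (m := 1) (by norm_num)).fderiv_right (m := 0) (by norm_num)).continuousAt
  unfold leviForm
  exact (((h.clm_apply continuousAt_const).clm_apply continuousAt_const).add
    ((h.clm_apply continuousAt_const).clm_apply continuousAt_const)).div_const 4

theorem continuousOn_leviForm {s : Set (ℂ × ℂ)} (hs : IsOpen s) {f : ℂ × ℂ → ℝ}
    (hf : ContDiffOn ℝ 2 f s) (a : ℂ × ℂ) : ContinuousOn (leviForm f a) s :=
  fun _ hx => (continuousAt_leviForm (hf.contDiffAt (hs.mem_nhds hx)) a).continuousWithinAt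

theorem continuous_leviForm {f : ℂ × ℂ → ℝ} (hf : ContDiff ℝ 2 f) (a : ℂ × ℂ) :
    Continuous (leviForm f a) :=
  continuous_iff_continuousAt.2 fun _ => continuousAt_leviForm hf.contDiffAt a

theorem leviForm_eq_zero_of_notMem_tsupport {f : ℂ × ℂ → ℝ} {p : ℂ × ℂ} (hp : p ∉ tsupport f)
    (a : ℂ × ℂ) : leviForm f a p = 0 := by
  rw [leviForm_congr (notMem_tsupport_iff_eventuallyEq.1 hp) a]
  have h0 : fderiv ℝ (0 : ℂ × ℂ → ℝ) = 0 := fderiv_fun_const (0 : ℝ)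
  simp [leviForm, h0]

theorem tsupport_leviForm_subset (f : ℂ × ℂ → ℝ) (a : ℂ × ℂ) :
    tsupport (leviForm f a) ⊆ tsupport f :=
  closure_minimal (fun _ hp => by_contra fun h => hp (leviForm_eq_zero_of_notMem_tsupport h a))
    (isClosed_tsupport f)

theorem hasCompactSupport_leviForm {f : ℂ × ℂ → ℝ} (hf : HasCompactSupport f) (a : ℂ × ℂ) :
    HasCompactSupport (leviForm f a) :=
  hf.of_isClosed_subset (isClosed_tsupport _) (tsupport_leviForm_subset f a)

theorem leviForm_add {f g : ℂ × ℂ → ℝ} {p : ℂ × ℂ} (hf : ContDiffAt ℝ 2 f p)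
    (hg : ContDiffAt ℝ 2 g p) (a : ℂ × ℂ) :
    leviForm (fun q => f q + g q) a p = leviForm f a p + leviForm g a p := by
  have h1 : fderiv ℝ (fun q => f q + g q) =ᶠ[𝓝 p] fun q => fderiv ℝ f q + fderiv ℝ g q := by
    filter_upwards [hf.eventually (by simp), hg.eventually (by simp)] with q hq hq'
    exact fderiv_fun_add (hq.differentiableAt (by norm_num)) (hq'.differentiableAt (by norm_num))
  have hf' : DifferentiableAt ℝ (fderiv ℝ f) p :=
    (hf.fderiv_right (m := 1) (by norm_num)).differentiableAt (by norm_num)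
  have hg' : DifferentiableAt ℝ (fderiv ℝ g) p :=
    (hg.fderiv_right (m := 1) (by norm_num)).differentiableAt (by norm_num)
  simp only [leviForm, h1.fderiv_eq, fderiv_fun_add hf' hg', add_apply]
  ring

theorem leviForm_const_mul {f : ℂ × ℂ → ℝ} (c : ℝ) (a p : ℂ × ℂ) :
    leviForm (fun q => c * f q) a p = c * leviForm f a p := by
  have h1 : fderiv ℝ (fun q => c * f q) = c • fderiv ℝ f := by
    ext1 q
    exact congrFun (fderiv_const_smul_field (𝕜 := ℝ) (f := f) c) q
  have h2 : fderiv ℝ (c • fderiv ℝ f) = c • fderiv ℝ (fderiv ℝ f) :=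
    fderiv_const_smul_field (𝕜 := ℝ) (f := fderiv ℝ f) c
  simp only [leviForm, h1, h2, smul_apply, smul_eq_mul, Pi.smul_apply]
  ring

instance isAddHaarMeasure_volume_complex_prod :
    (volume : Measure (ℂ × ℂ)).IsAddHaarMeasure :=
  inferInstanceAs ((volume : Measure ℂ).prod (volume : Measure ℂ)).IsAddHaarMeasure

/-- Two integrations by parts in the direction `a`. Differentiability of `v` is needed only on the
support of the other factor, which lies in `s`. -/
theorem integral_mul_fderiv_fderiv {s : Set (ℂ × ℂ)} (hs : IsOpen s) {v φ : ℂ × ℂ → ℝ}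
    (hv : ContDiffOn ℝ 2 v s) (hφ : ContDiff ℝ 2 φ) (hc : HasCompactSupport φ)
    (hφs : tsupport φ ⊆ s) (a : ℂ × ℂ) :
    ∫ p, v p * fderiv ℝ (fderiv ℝ φ) p a a = ∫ p, fderiv ℝ (fderiv ℝ v) p a a * φ p := by
  have hvat : ∀ x ∈ s, ContDiffAt ℝ 2 v x := fun x hx => hv.contDiffAt (hs.mem_nhds hx)
  set w : ℂ × ℂ → ℝ := fun y => fderiv ℝ v y a with hw
  set ψ : ℂ × ℂ → ℝ := fun y => fderiv ℝ φ y a with hψ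
  have hψ1 : ContDiff ℝ 1 ψ := (hφ.fderiv_right (m := 1) (by norm_num)).clm_apply contDiff_const
  have hψs : tsupport ψ ⊆ tsupport φ := tsupport_fderiv_apply_subset ℝ a
  have hψc : HasCompactSupport ψ := hc.of_isClosed_subset (isClosed_tsupport _) hψs
  set ψ' : ℂ × ℂ → ℝ := fun y => fderiv ℝ ψ y a with hψ'
  have hψ'1 : Continuous ψ' :=
    ((hψ1.fderiv_right (m := 0) (by norm_num)).clm_apply contDiff_const).continuous
  have hψ's : tsupport ψ' ⊆ tsupport ψ := tsupport_fderiv_apply_subset ℝ a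
  have hψ'c : HasCompactSupport ψ' := hψc.of_isClosed_subset (isClosed_tsupport _) hψ's
  have hwat : ∀ x ∈ s, ContDiffAt ℝ 1 w x := fun x hx => contDiffAt_fderiv_apply (hvat x hx) a
  have hw' : ContinuousOn (fun y => fderiv ℝ w y a) s := fun x hx =>
    (((hwat x hx).fderiv_right (m := 0) (by norm_num)).continuousAt.clm_apply
      continuousAt_const).continuousWithinAt
  have hwc : ContinuousOn w s := fun x hx => (hwat x hx).continuousAt.continuousWithinAt
  have e1 : ∫ p, v p * fderiv ℝ ψ p a = - ∫ p, fderiv ℝ v p a * ψ p := by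
    apply integral_mul_fderiv_eq_neg_fderiv_mul_of_integrable
    · exact integrable_mul_of_continuousOn hs hwc hψ1.continuous (hψs.trans hφs) hψc _
    · exact integrable_mul_of_continuousOn hs hv.continuousOn hψ'1
        ((hψ's.trans hψs).trans hφs) hψ'c _
    · exact integrable_mul_of_continuousOn hs hv.continuousOn hψ1.continuous (hψs.trans hφs) hψc _
    · exact fun x hx => (hvat x (hφs (hψs hx))).differentiableAt (by norm_num)
    · exact fun x _ => hψ1.contDiffAt.differentiableAt (by norm_num)
  have e2 : ∫ p, w p * fderiv ℝ φ p a = - ∫ p, fderiv ℝ w p a * φ p := by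
    apply integral_mul_fderiv_eq_neg_fderiv_mul_of_integrable
    · exact integrable_mul_of_continuousOn hs hw' hφ.continuous hφs hc _
    · exact integrable_mul_of_continuousOn hs hwc hψ1.continuous (hψs.trans hφs) hψc _
    · exact integrable_mul_of_continuousOn hs hwc hφ.continuous hφs hc _
    · exact fun x hx => (hwat x (hφs hx)).differentiableAt (by norm_num)
    · exact fun x _ => hφ.contDiffAt.differentiableAt (by norm_num)
  calc ∫ p, v p * fderiv ℝ (fderiv ℝ φ) p a a = ∫ p, v p * fderiv ℝ ψ p a :=
        integral_congr_ae (ae_of_all _ fun p => by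
          simp only [hψ, fderiv_fderiv_apply hφ.contDiffAt])
    _ = ∫ p, fderiv ℝ w p a * φ p := by
        rw [e1, neg_eq_iff_eq_neg]; exact e2
    _ = ∫ p, fderiv ℝ (fderiv ℝ v) p a a * φ p := by
        refine integral_congr_ae (ae_of_all _ fun p => ?_)
        by_cases hp : p ∈ tsupport φ
        · simp only [hw, fderiv_fderiv_apply (hvat p (hφs hp))]
        · simp [image_eq_zero_of_notMem_tsupport hp]

/-- Integration by parts for the Levi form. -/
theorem integral_mul_leviForm {s : Set (ℂ × ℂ)} (hs : IsOpen s) {v φ : ℂ × ℂ → ℝ}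
    (hv : ContDiffOn ℝ 2 v s) (hφ : ContDiff ℝ 2 φ) (hc : HasCompactSupport φ)
    (hφs : tsupport φ ⊆ s) (a : ℂ × ℂ) :
    ∫ p, v p * leviForm φ a p = ∫ p, leviForm v a p * φ p := by
  have hD : ∀ b, Integrable fun p => v p * fderiv ℝ (fderiv ℝ φ) p b b := fun b => by
    have hcont : Continuous fun p => fderiv ℝ (fderiv ℝ φ) p b b :=
      (((hφ.fderiv_right (m := 1) (by norm_num)).fderiv_right (m := 0) (by norm_num)).clm_apply
        contDiff_const).clm_apply contDiff_const |>.continuous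
    have hsub : tsupport (fun p => fderiv ℝ (fderiv ℝ φ) p b b) ⊆ tsupport φ := by
      refine closure_minimal (fun p hp => by_contra fun h => hp ?_) (isClosed_tsupport φ)
      have h0 : fderiv ℝ (0 : ℂ × ℂ → ℝ) = 0 := fderiv_fun_const (0 : ℝ)
      have := ((notMem_tsupport_iff_eventuallyEq.1 h).fderiv (𝕜 := ℝ)).fderiv_eq (𝕜 := ℝ)
      simp [this, h0]
    exact integrable_mul_of_continuousOn hs hv.continuousOn hcont (hsub.trans hφs)
      (hc.of_isClosed_subset (isClosed_tsupport _) hsub) _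
  have hV : ∀ b, Integrable fun p => fderiv ℝ (fderiv ℝ v) p b b * φ p := fun b => by
    refine integrable_mul_of_continuousOn hs (fun x hx => ?_) hφ.continuous hφs hc _
    have h : ContinuousAt (fderiv ℝ (fderiv ℝ v)) x :=
      (((hv.contDiffAt (hs.mem_nhds hx)).fderiv_right (m := 1) (by norm_num)).fderiv_right
        (m := 0) (by norm_num)).continuousAt
    exact ((h.clm_apply continuousAt_const).clm_apply continuousAt_const).continuousWithinAt
  have l : ∀ p, v p * leviForm φ a p = (v p * fderiv ℝ (fderiv ℝ φ) p a a
      + v p * fderiv ℝ (fderiv ℝ φ) p (Complex.I • a) (Complex.I • a)) / 4 := fun p => by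
    simp only [leviForm]; ring
  have r : ∀ p, leviForm v a p * φ p = (fderiv ℝ (fderiv ℝ v) p a a * φ p
      + fderiv ℝ (fderiv ℝ v) p (Complex.I • a) (Complex.I • a) * φ p) / 4 := fun p => by
    simp only [leviForm]; ring
  simp only [l, r, integral_div]
  rw [integral_add (hD _) (hD _), integral_add (hV _) (hV _),
    integral_mul_fderiv_fderiv hs hv hφ hc hφs, integral_mul_fderiv_fderiv hs hv hφ hc hφs]

/-! ### Positive distributions as Radon measures -/

theorem exists_testFunction_eq_one {Ω : Opens (ℂ × ℂ)} {K : Set (ℂ × ℂ)} (hK : IsCompact K)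
    (hKΩ : K ⊆ Ω) : ∃ ρ : 𝓓(Ω, ℝ), (∀ p, 0 ≤ ρ p) ∧ ∀ p ∈ K, ρ p = 1 := by
  obtain ⟨L, hL, hKL, hLΩ⟩ := exists_compact_between hK Ω.isOpen hKΩ
  obtain ⟨f, hf0, hf1, hf⟩ := exists_contMDiffMap_zero_one_of_isClosed (n := ⊤) 𝓘(ℝ, ℂ × ℂ)
    (s := (interior L)ᶜ) (t := K) isOpen_interior.isClosed_compl hK.isClosed
    (Set.disjoint_left.2 fun x hx hx' => hx (hKL hx'))
  have hsub : tsupport f ⊆ L :=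
    closure_minimal (fun x hx => interior_subset (by_contra fun h => hx (hf0 h))) hL.isClosed
  exact ⟨⟨f, f.contMDiff.contDiff, hL.of_isClosed_subset (isClosed_tsupport _) hsub,
    hsub.trans hLΩ⟩, fun p => (hf p).1, fun p hp => hf1 hp⟩

theorem TestFunction.contDiff_two {Ω : Opens (ℂ × ℂ)} (φ : 𝓓(Ω, ℝ)) : ContDiff ℝ 2 φ :=
  φ.contDiff.of_le (WithTop.coe_le_coe.2 le_top)

theorem integrable_mul_leviForm {Ω : Opens (ℂ × ℂ)} {v : ℂ × ℂ → ℝ} (hv : ContinuousOn v Ω)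
    (φ : 𝓓(Ω, ℝ)) (a : ℂ × ℂ) : Integrable fun p => v p * leviForm φ a p :=
  integrable_mul_of_continuousOn Ω.isOpen hv (continuous_leviForm φ.contDiff_two a)
    ((tsupport_leviForm_subset φ a).trans φ.tsupport_subset)
    (hasCompactSupport_leviForm φ.hasCompactSupport a) _

theorem setIntegral_mul_leviForm {Ω : Opens (ℂ × ℂ)} (v : ℂ × ℂ → ℝ) (φ : 𝓓(Ω, ℝ))
    (a : ℂ × ℂ) :
    ∫ p in (Ω : Set (ℂ × ℂ)), v p * leviForm φ a p = ∫ p, v p * leviForm φ a p := by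
  refine setIntegral_eq_integral_of_forall_compl_eq_zero fun p hp => ?_
  rw [leviForm_eq_zero_of_notMem_tsupport (fun h => hp (φ.tsupport_subset h)), mul_zero]

/-- Restriction of a test function to the open set that carries it. -/
noncomputable def testRestrict (Ω : Opens (ℂ × ℂ)) : 𝓓(Ω, ℝ) →ₗ[ℝ] C_c(Ω, ℝ) where
  toFun φ :=
    { toFun := fun p => φ p
      continuous_toFun := φ.continuous.comp continuous_subtype_val
      hasCompactSupport' := by
        have hK : IsCompact ((↑) ⁻¹' tsupport φ : Set Ω) :=
          (IsInducing.subtypeVal.isCompact_preimage_iff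
            (by simpa using φ.tsupport_subset)).2 φ.hasCompactSupport
        exact HasCompactSupport.of_support_subset_isCompact hK fun p hp => subset_tsupport _ hp }
  map_add' φ ψ := by ext; rfl
  map_smul' c φ := by ext; rfl

theorem testRestrict_injective (Ω : Opens (ℂ × ℂ)) : Function.Injective (testRestrict Ω) := by
  intro φ ψ h
  ext p
  by_cases hp : p ∈ Ω
  · exact congrArg (fun f : C_c(Ω, ℝ) => f ⟨p, hp⟩) h
  · rw [image_eq_zero_of_notMem_tsupport fun h => hp (φ.tsupport_subset h),
      image_eq_zero_of_notMem_tsupport fun h => hp (ψ.tsupport_subset h)]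

/-- A positive functional on the test functions of `Ω` is given by a Radon measure on `Ω`. -/
theorem exists_measure_of_nonneg (Ω : Opens (ℂ × ℂ)) (Λ : 𝓓(Ω, ℝ) →ₗ[ℝ] ℝ)
    (hΛ : ∀ φ : 𝓓(Ω, ℝ), (∀ p, 0 ≤ φ p) → 0 ≤ Λ φ) :
    ∃ μ : Measure (ℂ × ℂ), μ (Ω : Set (ℂ × ℂ))ᶜ = 0 ∧
      (∀ K : Set (ℂ × ℂ), K ⊆ Ω → IsCompact K → μ K < ⊤) ∧ ∀ φ : 𝓓(Ω, ℝ), ∫ p, φ p ∂μ = Λ φ := by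
  set e := LinearEquiv.ofInjective (testRestrict Ω) (testRestrict_injective Ω)
  let f : C_c(Ω, ℝ) →ₗ.[ℝ] ℝ := ⟨LinearMap.range (testRestrict Ω), Λ ∘ₗ e.symm.toLinearMap⟩
  let s : PointedCone ℝ C_c(Ω, ℝ) :=
    { carrier := {g | ∀ p, 0 ≤ g p}
      add_mem' := fun ha hb p => add_nonneg (ha p) (hb p)
      zero_mem' := fun p => le_rfl
      smul_mem' := fun c g hg p => mul_nonneg c.2 (hg p) }
  have hfe : ∀ φ, f (e φ) = Λ φ := fun φ => congrArg Λ (e.symm_apply_apply φ)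
  -- M. Riesz extension: the functional is positive on the subspace of restricted test functions,
  -- and every element of `C_c(Ω, ℝ)` is dominated by that subspace, so a positive extension to
  -- `C_c(Ω, ℝ)` exists. Riesz-Markov-Kakutani then gives a measure on the subtype, which is pushed
  -- forward to `ℂ × ℂ`.
  obtain ⟨g, hgf, hg0⟩ := riesz_extension s f
    (fun x hx => by
      obtain ⟨φ, rfl⟩ := e.surjective x
      rw [hfe]
      refine hΛ φ fun p => ?_
      by_cases hp : p ∈ Ω
      · exact hx ⟨p, hp⟩
      · rw [image_eq_zero_of_notMem_tsupport fun h => hp (φ.tsupport_subset h)])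
    (fun y => by
      obtain ⟨C, hC⟩ := y.hasCompactSupport.exists_bound_of_continuous y.continuous
      obtain ⟨ρ, hρ0, hρ1⟩ := exists_testFunction_eq_one (Ω := Ω)
        (K := (↑) '' tsupport y) (y.hasCompactSupport.isCompact.image continuous_subtype_val)
        (by rintro _ ⟨p, -, rfl⟩; exact p.2)
      -- Domination: with `|y| ≤ C` and `ρ = 1` on the support of `y`, the sum `|C| ρ + y` is
      -- nonnegative.
      refine ⟨e (|C| • ρ), fun p => ?_⟩
      change 0 ≤ |C| * ρ p + y p
      by_cases hp : p ∈ tsupport y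
      · rw [hρ1 p ⟨p, hp, rfl⟩]
        have := abs_le.1 ((hC p).trans (le_abs_self C))
        linarith [this.1]
      · rw [image_eq_zero_of_notMem_tsupport hp]
        have := mul_nonneg (abs_nonneg C) (hρ0 p)
        linarith)
  have : LocallyCompactSpace Ω := Ω.isOpen.locallyCompactSpace
  let P : C_c(Ω, ℝ) →ₚ[ℝ] ℝ := PositiveLinearMap.mk₀ g fun x hx => hg0 x hx
  have hemb : MeasurableEmbedding ((↑) : Ω → ℂ × ℂ) := .subtype_coe Ω.isOpen.measurableSet
  refine ⟨(RealRMK.rieszMeasure P).map (↑), ?_, fun K hKΩ hK => ?_, fun φ => ?_⟩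
  · rw [hemb.map_apply]
    convert measure_empty (μ := RealRMK.rieszMeasure P)
    ext p
    simp
  · rw [hemb.map_apply]
    have : IsCompact ((↑) ⁻¹' K : Set Ω) :=
      (IsInducing.subtypeVal.isCompact_preimage_iff (by simpa using hKΩ)).2 hK
    exact this.measure_lt_top
  · rw [hemb.integral_map]
    refine (RealRMK.integral_rieszMeasure P (testRestrict Ω φ)).trans ?_
    exact (hgf (e φ)).trans (hfe φ)

/-- If the distribution `∑ a_j (conj a_k) ∂²v/∂z_j∂z̄_k` is positive, then it is a measure. -/
theorem exists_isLeviMeasure {Ω : Opens (ℂ × ℂ)} {v : ℂ × ℂ → ℝ} (hv : ContinuousOn v Ω)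
    (a : ℂ × ℂ) (hpos : ∀ φ : 𝓓(Ω, ℝ), (∀ p, 0 ≤ φ p) → 0 ≤ ∫ p, v p * leviForm φ a p) :
    ∃ μ, IsLeviMeasure Ω v a μ := by
  let Λ : 𝓓(Ω, ℝ) →ₗ[ℝ] ℝ :=
    { toFun := fun φ => ∫ p, v p * leviForm φ a p
      map_add' := fun φ ψ => by
        rw [← integral_add (integrable_mul_leviForm hv φ a) (integrable_mul_leviForm hv ψ a)]
        refine integral_congr_ae (ae_of_all _ fun p => ?_)
        have := leviForm_add φ.contDiff_two.contDiffAt ψ.contDiff_two.contDiffAt a (p := p)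
        calc _ = v p * leviForm (fun q => φ q + ψ q) a p := rfl
          _ = _ := by rw [this, mul_add]
      map_smul' := fun c φ => by
        rw [RingHom.id_apply, smul_eq_mul, ← integral_const_mul]
        refine integral_congr_ae (ae_of_all _ fun p => ?_)
        have := leviForm_const_mul (f := φ) c a p
        calc _ = v p * leviForm (fun q => c * φ q) a p := rfl
          _ = _ := by rw [this, mul_left_comm] }
  obtain ⟨μ, h1, h2, h3⟩ := exists_measure_of_nonneg Ω Λ hpos
  exact ⟨μ, h1, h2, fun φ => (h3 φ).trans (setIntegral_mul_leviForm v φ a).symm⟩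

/-- Convergence of the distributional Levi forms under uniform convergence. -/
theorem tendsto_integral_mul_leviForm {Ω : Opens (ℂ × ℂ)} {v : ℂ × ℂ → ℝ}
    {w : ℕ → ℂ × ℂ → ℝ} (hv : ContinuousOn v Ω) (hw : ∀ n, ContinuousOn (w n) Ω)
    (hwv : TendstoUniformlyOn w v atTop Ω) (φ : 𝓓(Ω, ℝ)) (a : ℂ × ℂ) :
    Tendsto (fun n => ∫ p, w n p * leviForm φ a p) atTop (𝓝 (∫ p, v p * leviForm φ a p)) := by
  have hzero : ∀ p ∉ Ω, leviForm φ a p = 0 := fun p hp =>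
    leviForm_eq_zero_of_notMem_tsupport (fun h => hp (φ.tsupport_subset h)) a
  refine tendsto_integral_filter_of_dominated_convergence
    -- Once `w n` is within `1` of `v`, this bounds `|w n| |leviForm φ a|`.
    (fun p => |v p * leviForm φ a p| + |1 * leviForm φ a p|)
    (Eventually.of_forall fun n => (integrable_mul_leviForm (hw n) φ a).aestronglyMeasurable)
    ?_ ?_ ?_
  · filter_upwards [Metric.tendstoUniformlyOn_iff.1 hwv 1 one_pos] with n hn
    refine ae_of_all _ fun p => ?_
    by_cases hp : p ∈ Ω
    · have h1 := hn p hp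
      rw [Real.norm_eq_abs]
      simp only [abs_mul]
      rw [← add_mul]
      refine mul_le_mul_of_nonneg_right ?_ (abs_nonneg _)
      rw [Real.dist_eq, abs_sub_comm] at h1
      have := abs_sub_abs_le_abs_sub (w n p) (v p)
      rw [abs_one]
      linarith
    · simp [hzero p hp]
  · exact (integrable_mul_leviForm hv φ a).abs.add
      (integrable_mul_leviForm continuousOn_const φ a).abs
  · refine ae_of_all _ fun p => ?_
    by_cases hp : p ∈ Ω
    · exact (hwv.tendsto_at hp).mul_const _
    · simp [hzero p hp]

/-! ### Levi measures under uniform convergence -/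

theorem IsLeviMeasure.integrable {Ω : Opens (ℂ × ℂ)} {v : ℂ × ℂ → ℝ} {a : ℂ × ℂ}
    {μ : Measure (ℂ × ℂ)} (hμ : IsLeviMeasure Ω v a μ) {f : ℂ × ℂ → ℝ} (hf : Continuous f)
    (hc : HasCompactSupport f) (hs : tsupport f ⊆ Ω) : Integrable f μ := by
  obtain ⟨C, hC⟩ := hc.exists_bound_of_continuous hf
  rw [← integrableOn_iff_integrable_of_support_subset (subset_tsupport f)]
  exact Measure.integrableOn_of_bounded (hμ.lt_top_of_isCompact _ hs hc).ne
    hf.aestronglyMeasurable (ae_of_all _ hC)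

theorem IsLeviMeasure.abs_integral_le {Ω : Opens (ℂ × ℂ)} {v : ℂ × ℂ → ℝ} {a : ℂ × ℂ}
    {μ : Measure (ℂ × ℂ)} (hμ : IsLeviMeasure Ω v a μ) {f : ℂ × ℂ → ℝ} {ρ : 𝓓(Ω, ℝ)}
    (hρ : ∀ p, 0 ≤ ρ p) (hρ1 : ∀ p, f p ≠ 0 → ρ p = 1) {c : ℝ} (hc : 0 ≤ c)
    (hfc : ∀ p, |f p| ≤ c) : |∫ p, f p ∂μ| ≤ c * ∫ p, ρ p ∂μ := by
  rw [← integral_const_mul, ← Real.norm_eq_abs]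
  refine norm_integral_le_of_norm_le
    ((hμ.integrable ρ.continuous ρ.hasCompactSupport ρ.tsupport_subset).const_mul c)
    (ae_of_all _ fun p => ?_)
  by_cases hp : f p = 0
  · simpa [hp] using mul_nonneg hc (hρ p)
  · simpa [hρ1 p hp] using hfc p

/-- Weak convergence of the Levi measures under uniform convergence, against continuous functions
that converge uniformly. -/
theorem tendsto_integral_isLeviMeasure {Ω : Opens (ℂ × ℂ)} {v : ℂ × ℂ → ℝ}
    {w : ℕ → ℂ × ℂ → ℝ} (hv : ContinuousOn v Ω) (hw : ∀ n, ContinuousOn (w n) Ω)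
    (hwv : TendstoUniformlyOn w v atTop Ω) {a : ℂ × ℂ} {μ : Measure (ℂ × ℂ)}
    {ν : ℕ → Measure (ℂ × ℂ)} (hμ : IsLeviMeasure Ω v a μ)
    (hν : ∀ n, IsLeviMeasure Ω (w n) a (ν n)) {K : Set (ℂ × ℂ)} (hK : IsCompact K)
    (hKΩ : K ⊆ Ω) {f : ℂ × ℂ → ℝ} {g : ℕ → ℂ × ℂ → ℝ} (hf : Continuous f)
    (hg : ∀ n, Continuous (g n)) (hfK : tsupport f ⊆ K) (hgK : ∀ n, tsupport (g n) ⊆ K)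
    (hgf : TendstoUniformly g f atTop) :
    Tendsto (fun n => ∫ p, g n p ∂(ν n)) atTop (𝓝 (∫ p, f p ∂μ)) := by
  -- Against a test function the convergence is that of the distributions. A continuous integrand is
  -- reduced to this case by smooth approximation; the error is controlled by the masses on `K`,
  -- which are bounded because the integrals of `ρ` converge.
  have key : ∀ φ : 𝓓(Ω, ℝ), Tendsto (fun n => ∫ p, φ p ∂(ν n)) atTop (𝓝 (∫ p, φ p ∂μ)) :=
    fun φ => by
      simp only [(hν _).integral_eq, hμ.integral_eq, setIntegral_mul_leviForm]
      exact tendsto_integral_mul_leviForm hv hw hwv φ a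
  obtain ⟨ρ, hρ0, hρ1⟩ := exists_testFunction_eq_one hK hKΩ
  have hM0 : 0 ≤ ∫ p, ρ p ∂μ := integral_nonneg hρ0
  set M := ∫ p, ρ p ∂μ
  rw [Metric.tendsto_atTop']
  intro ε hε
  -- With this `δ` the three errors are at most `5ε/16`, `ε/8` and `ε/4`.
  set δ := ε / (4 * (M + 1)) with hδ
  have hδ0 : 0 < δ := by positivity
  obtain ⟨h, hh, hhf, hhs⟩ := hf.exists_contDiff_approx ⊤ (ε := fun _ => δ) continuous_const
    (fun _ => hδ0)
  have hhK : tsupport h ⊆ K := (closure_mono hhs).trans hfK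
  let H : 𝓓(Ω, ℝ) := ⟨h, hh, hK.of_isClosed_subset (isClosed_tsupport _) hhK, hhK.trans hKΩ⟩
  have hInt : ∀ {v' μ'} (_ : IsLeviMeasure Ω v' a μ') {k : ℂ × ℂ → ℝ} (_ : Continuous k)
      (_ : tsupport k ⊆ K), Integrable k μ' := fun hμ' _ hk hkK =>
    hμ'.integrable hk (hK.of_isClosed_subset (isClosed_tsupport _) hkK) (hkK.trans hKΩ)
  have hmem : ∀ {k : ℂ × ℂ → ℝ} {p}, tsupport k ⊆ K → p ∉ K → k p = 0 := fun hk hp =>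
    image_eq_zero_of_notMem_tsupport fun h => hp (hk h)
  have hone : ∀ {k l : ℂ × ℂ → ℝ}, tsupport k ⊆ K → tsupport l ⊆ K →
      ∀ p, k p - l p ≠ 0 → ρ p = 1 := fun hk hl p hp => hρ1 p <| by
    by_contra hpK
    exact hp (by rw [hmem hk hpK, hmem hl hpK, sub_zero])
  have e1 := (Metric.tendsto_atTop'.1 (key H)) (ε / 8) (by positivity)
  have e2 := (Metric.tendsto_atTop'.1 (key ρ)) (1 / 4) (by norm_num)
  obtain ⟨N1, e1⟩ := e1
  obtain ⟨N2, e2⟩ := e2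
  obtain ⟨N3, e3⟩ := eventually_atTop.1 (Metric.tendstoUniformly_iff.1 hgf (δ / 4) (by positivity))
  refine ⟨max N1 (max N2 N3), fun n hn => ?_⟩
  have d1 := e1 n (lt_of_le_of_lt (le_max_left _ _) hn)
  have d2 := e2 n (lt_of_le_of_lt ((le_max_left _ _).trans (le_max_right _ _)) hn)
  have d3 := e3 n (((le_max_right _ _).trans (le_max_right _ _)).trans hn.le)
  have b1 : |∫ p, g n p - h p ∂(ν n)| ≤ (δ + δ / 4) * ∫ p, ρ p ∂(ν n) := by
    refine (hν n).abs_integral_le hρ0 (hone (hgK n) hhK) (by positivity) fun p => ?_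
    have h1 := d3 p
    have h2 := hhf p
    rw [Real.dist_eq, abs_sub_comm] at h1 h2
    have := abs_sub_le (g n p) (f p) (h p)
    linarith
  have b2 : |∫ p, h p - f p ∂μ| ≤ δ * M := by
    refine hμ.abs_integral_le hρ0 (hone hhK hfK) hδ0.le fun p => ?_
    have h2 := hhf p
    rw [Real.dist_eq] at h2
    exact h2.le
  rw [integral_sub (hInt (hν n) (hg n) (hgK n)) (hInt (hν n) hh.continuous hhK)] at b1
  rw [integral_sub (hInt hμ hh.continuous hhK) (hInt hμ hf hfK)] at b2
  rw [Real.dist_eq] at d1 d2 ⊢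
  change |∫ p, h p ∂(ν n) - ∫ p, h p ∂μ| < ε / 8 at d1
  have hMn : ∫ p, ρ p ∂(ν n) ≤ M + 1 / 4 := by linarith [(abs_lt.1 d2).2]
  have b3 : (δ + δ / 4) * ∫ p, ρ p ∂(ν n) ≤ (δ + δ / 4) * (M + 1 / 4) :=
    mul_le_mul_of_nonneg_left hMn (by positivity)
  have hδM : δ * (M + 1) = ε / 4 := by rw [hδ]; field_simp
  have t1 := abs_sub_le (∫ p, g n p ∂(ν n)) (∫ p, h p ∂(ν n)) (∫ p, f p ∂μ)
  have t2 := abs_sub_le (∫ p, h p ∂(ν n)) (∫ p, h p ∂μ) (∫ p, f p ∂μ)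
  nlinarith

theorem isLeviMeasure_leviMeasure {Ω : Opens (ℂ × ℂ)} {v : ℂ × ℂ → ℝ} (h : HasLeviMeasures Ω v)
    (a : ℂ × ℂ) : IsLeviMeasure Ω v a (leviMeasure Ω v a) := by
  rw [leviMeasure, dif_pos (h a)]
  exact (h a).choose_spec

/-- Positivity of a distribution is a closed condition: it holds for each `w n` after integration by
parts, and it passes to the limit on each test function. -/
theorem hasLeviMeasures_of_tendstoUniformlyOn {Ω : Opens (ℂ × ℂ)} {v : ℂ × ℂ → ℝ}
    {w : ℕ → ℂ × ℂ → ℝ} (hw : ∀ n, ContDiffOn ℝ 2 (w n) Ω)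
    (hwpos : ∀ n a, ∀ᵐ p ∂(volume.restrict (Ω : Set (ℂ × ℂ))), 0 ≤ leviForm (w n) a p)
    (hwv : TendstoUniformlyOn w v atTop Ω) : HasLeviMeasures Ω v := by
  have hv : ContinuousOn v Ω :=
    hwv.continuousOn (Frequently.of_forall fun n => (hw n).continuousOn)
  refine fun a => exists_isLeviMeasure hv a fun φ hφ => ?_
  refine ge_of_tendsto (tendsto_integral_mul_leviForm hv (fun n => (hw n).continuousOn) hwv φ a)
    (Eventually.of_forall fun n => ?_)
  rw [integral_mul_leviForm Ω.isOpen (hw n) φ.contDiff_two φ.hasCompactSupport φ.tsupport_subset]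
  refine integral_nonneg_of_ae ?_
  filter_upwards [(ae_restrict_iff' Ω.isOpen.measurableSet).1 (hwpos n a)] with p hp
  by_cases h : p ∈ Ω
  · exact mul_nonneg (hp h) (hφ p)
  · simp [image_eq_zero_of_notMem_tsupport fun h' => h (φ.tsupport_subset h')]

theorem tendstoUniformly_mul_of_hasCompactSupport {s : Set (ℂ × ℂ)} {v : ℂ × ℂ → ℝ}
    {w : ℕ → ℂ × ℂ → ℝ} (hwv : TendstoUniformlyOn w v atTop s) {ψ : ℂ × ℂ → ℝ}
    (hψ : Continuous ψ) (hc : HasCompactSupport ψ) (hs : tsupport ψ ⊆ s) :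
    TendstoUniformly (fun n p => w n p * ψ p) (fun p => v p * ψ p) atTop := by
  obtain ⟨C, hC⟩ := hc.exists_bound_of_continuous hψ
  rw [Metric.tendstoUniformly_iff]
  intro ε hε
  filter_upwards [Metric.tendstoUniformlyOn_iff.1 hwv (ε / (|C| + 1)) (by positivity)] with n hn p
  by_cases hp : p ∈ s
  · have h1 := hn p hp
    have h2 : |ψ p| < |C| + 1 := by
      have := hC p
      rw [Real.norm_eq_abs] at this
      linarith [le_abs_self C]
    rw [Real.dist_eq] at h1 ⊢
    rw [← sub_mul, abs_mul]
    calc |v p - w n p| * |ψ p| ≤ |v p - w n p| * (|C| + 1) :=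
          mul_le_mul_of_nonneg_left h2.le (abs_nonneg _)
      _ < ε / (|C| + 1) * (|C| + 1) := mul_lt_mul_of_pos_right h1 (by positivity)
      _ = ε := by field_simp
  · simpa [image_eq_zero_of_notMem_tsupport fun h => hp (hs h)] using hε

theorem tendsto_integral_mul_leviMeasure {Ω : Opens (ℂ × ℂ)} {v : ℂ × ℂ → ℝ}
    {w : ℕ → ℂ × ℂ → ℝ} (hv : ContinuousOn v Ω) (hw : ∀ n, ContinuousOn (w n) Ω)
    (hwv : TendstoUniformlyOn w v atTop Ω) (hlv : HasLeviMeasures Ω v)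
    (hlw : ∀ n, HasLeviMeasures Ω (w n)) {ψ : ℂ × ℂ → ℝ} (hψ : Continuous ψ)
    (hc : HasCompactSupport ψ) (hs : tsupport ψ ⊆ Ω) (a : ℂ × ℂ) :
    Tendsto (fun n => ∫ p, w n p * ψ p ∂(leviMeasure Ω (w n) a)) atTop
      (𝓝 (∫ p, v p * ψ p ∂(leviMeasure Ω v a))) :=
  tendsto_integral_isLeviMeasure hv hw hwv (isLeviMeasure_leviMeasure hlv a)
    (fun n => isLeviMeasure_leviMeasure (hlw n) a) hc hs
    (continuous_mul_of_continuousOn Ω.isOpen hv hψ hs)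
    (fun n => continuous_mul_of_continuousOn Ω.isOpen (hw n) hψ hs)
    (tsupport_mul_subset_right) (fun _ => tsupport_mul_subset_right)
    (tendstoUniformly_mul_of_hasCompactSupport hwv hψ hc hs)

/-- The Levi measure of a function of class `C²` is given by its Levi form. -/
theorem integral_leviMeasure_of_contDiffOn {Ω : Opens (ℂ × ℂ)} {v : ℂ × ℂ → ℝ}
    (hv : ContDiffOn ℝ 2 v Ω) {a : ℂ × ℂ}
    (hpos : ∀ᵐ p ∂(volume.restrict (Ω : Set (ℂ × ℂ))), 0 ≤ leviForm v a p)
    (hlv : HasLeviMeasures Ω v) {f : ℂ × ℂ → ℝ} (hf : Continuous f) (hc : HasCompactSupport f)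
    (hs : tsupport f ⊆ Ω) :
    ∫ p, f p ∂(leviMeasure Ω v a) = ∫ p, leviForm v a p * f p := by
  have hcont := continuousOn_leviForm Ω.isOpen hv a
  set μ : Measure (ℂ × ℂ) := (volume.restrict (Ω : Set (ℂ × ℂ))).withDensity
    fun p => ENNReal.ofReal (leviForm v a p) with hμdef
  have hmeas : AEMeasurable (leviForm v a) (volume.restrict (Ω : Set (ℂ × ℂ))) :=
    hcont.aemeasurable Ω.isOpen.measurableSet
  have hInt : ∀ k : ℂ × ℂ → ℝ, tsupport k ⊆ Ω →
      ∫ p, k p ∂μ = ∫ p, leviForm v a p * k p := fun k hk => by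
    rw [hμdef, integral_withDensity_eq_integral_toReal_smul₀ hmeas.ennreal_ofReal
      (ae_of_all _ fun _ => ENNReal.ofReal_lt_top)]
    rw [← setIntegral_eq_integral_of_forall_compl_eq_zero (s := (Ω : Set (ℂ × ℂ)))
      (f := fun p => leviForm v a p * k p)]
    · refine integral_congr_ae ?_
      filter_upwards [hpos] with p hp
      simp [ENNReal.toReal_ofReal hp]
    · intro p hp
      rw [image_eq_zero_of_notMem_tsupport fun h => hp (hk h), mul_zero]
  -- `leviMeasure` is a chosen measure, so the density measure `μ` must be shown to have the same
  -- integrals. Uniqueness comes from the convergence theorem for constant sequences: the constant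
  -- integrals against `leviMeasure` converge to the integral against `μ`.
  have hμ : IsLeviMeasure Ω v a μ := by
    refine ⟨?_, fun K hKΩ hK => ?_, fun φ => ?_⟩
    · exact (withDensity_absolutelyContinuous _ _)
        (by rw [Measure.restrict_apply Ω.isOpen.measurableSet.compl]; simp)
    · rw [hμdef, withDensity_apply _ hK.measurableSet, Measure.restrict_restrict hK.measurableSet,
        Set.inter_eq_left.2 hKΩ]
      have := ((hcont.mono hKΩ).integrableOn_compact hK (μ := volume)).lintegral_lt_top
      exact this
    · rw [hInt φ φ.tsupport_subset, setIntegral_mul_leviForm,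
        integral_mul_leviForm Ω.isOpen hv φ.contDiff_two φ.hasCompactSupport φ.tsupport_subset]
  rw [← hInt f hs]
  refine tendsto_nhds_unique (tendsto_const_nhds (x := ∫ p, f p ∂(leviMeasure Ω v a))
    (f := (atTop : Filter ℕ))) ?_
  exact tendsto_integral_isLeviMeasure (w := fun _ => v) (ν := fun _ => leviMeasure Ω v a)
    (g := fun _ => f) hv.continuousOn (fun _ => hv.continuousOn)
    (Metric.tendstoUniformlyOn_iff.2 fun ε hε => Eventually.of_forall fun _ p _ => by
      simpa using hε) hμ
    (fun _ => isLeviMeasure_leviMeasure hlv a) hc hs hf (fun _ => hf) subset_rfl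
    (fun _ => subset_rfl)
    (Metric.tendstoUniformly_iff.2 fun ε hε => Eventually.of_forall fun _ p => by
      simpa using hε)

/-! ### The Monge-Ampère functional: continuity and pointwise formula -/

section Linearity

variable {α : Type*} [MeasurableSpace α] {μ : Measure α} {F G H K : α → ℝ}

theorem integral_half_sub (hF : Integrable F μ) (hG : Integrable G μ) (hH : Integrable H μ) :
    Integrable (fun p => (F p - G p - H p) / 2) μ ∧
      ∫ p, (F p - G p - H p) / 2 ∂μ = (∫ p, F p ∂μ - ∫ p, G p ∂μ - ∫ p, H p ∂μ) / 2 := by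
  have h : Integrable (fun p => F p - G p) μ := hF.sub hG
  exact ⟨(h.sub hH).div_const 2, by rw [integral_div, integral_sub h hH, integral_sub hF hG]⟩

theorem integral_add_sub_sub (hF : Integrable F μ) (hG : Integrable G μ) (hH : Integrable H μ)
    (hK : Integrable K μ) :
    Integrable (fun p => F p + G p - 2 * H p - 2 * K p) μ ∧
      ∫ p, F p + G p - 2 * H p - 2 * K p ∂μ
        = ∫ p, F p ∂μ + ∫ p, G p ∂μ - 2 * ∫ p, H p ∂μ - 2 * ∫ p, K p ∂μ := by
  have h : Integrable (fun p => F p + G p) μ := hF.add hG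
  have h' : Integrable (fun p => F p + G p - 2 * H p) μ := h.sub (hH.const_mul 2)
  exact ⟨h'.sub (hK.const_mul 2), by
    rw [integral_sub h' (hK.const_mul 2), integral_sub h (hH.const_mul 2), integral_add hF hG,
      integral_const_mul, integral_const_mul]⟩

end Linearity

section MongeAmpere

variable {Ω : Opens (ℂ × ℂ)} {v : ℂ × ℂ → ℝ} {w : ℕ → ℂ × ℂ → ℝ}

theorem continuous_leviForm_comb (φ : 𝓓(Ω, ℝ)) (a b c : ℂ × ℂ) :
    Continuous fun p => (leviForm φ a p - leviForm φ b p - leviForm φ c p) / 2 :=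
  (((continuous_leviForm φ.contDiff_two a).sub (continuous_leviForm φ.contDiff_two b)).sub
    (continuous_leviForm φ.contDiff_two c)).div_const 2

theorem tsupport_leviForm_comb_subset (φ : 𝓓(Ω, ℝ)) (a b c : ℂ × ℂ) :
    tsupport (fun p => (leviForm φ a p - leviForm φ b p - leviForm φ c p) / 2) ⊆ tsupport φ := by
  refine closure_minimal (fun p hp => by_contra fun h => hp ?_) (isClosed_tsupport _)
  simp [leviForm_eq_zero_of_notMem_tsupport h]

theorem tendsto_mongeAmpere (hv : ContinuousOn v Ω) (hw : ∀ n, ContinuousOn (w n) Ω)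
    (hwv : TendstoUniformlyOn w v atTop Ω) (hlv : HasLeviMeasures Ω v)
    (hlw : ∀ n, HasLeviMeasures Ω (w n)) (φ : 𝓓(Ω, ℝ)) :
    Tendsto (fun n => mongeAmpere Ω (w n) φ) atTop (𝓝 (mongeAmpere Ω v φ)) := by
  have h1 : ∀ a b, Tendsto (fun n => ∫ p, w n p * leviForm φ b p ∂(leviMeasure Ω (w n) a)) atTop
      (𝓝 (∫ p, v p * leviForm φ b p ∂(leviMeasure Ω v a))) := fun a b =>
    tendsto_integral_mul_leviMeasure hv hw hwv hlv hlw (continuous_leviForm φ.contDiff_two b)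
      (hasCompactSupport_leviForm φ.hasCompactSupport b)
      ((tsupport_leviForm_subset φ b).trans φ.tsupport_subset) a
  have h2 : ∀ a b c d, Tendsto (fun n => ∫ p, w n p *
        ((leviForm φ b p - leviForm φ c p - leviForm φ d p) / 2) ∂(leviMeasure Ω (w n) a)) atTop
      (𝓝 (∫ p, v p * ((leviForm φ b p - leviForm φ c p - leviForm φ d p) / 2)
        ∂(leviMeasure Ω v a))) := fun a b c d =>
    tendsto_integral_mul_leviMeasure hv hw hwv hlv hlw (continuous_leviForm_comb φ b c d)
      (φ.hasCompactSupport.of_isClosed_subset (isClosed_tsupport _)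
        (tsupport_leviForm_comb_subset φ b c d))
      ((tsupport_leviForm_comb_subset φ b c d).trans φ.tsupport_subset) a
  simp only [mongeAmpere, coeff11, coeff22, coeffRe12, coeffIm12]
  exact ((((h1 _ _).add (h1 _ _)).sub ((((h2 _ _ _ _).sub (h2 _ _ _ _)).sub
    (h2 _ _ _ _)).div_const 2 |>.const_mul 2)).sub ((((h2 _ _ _ _).sub (h2 _ _ _ _)).sub
    (h2 _ _ _ _)).div_const 2 |>.const_mul 2)).const_mul 16

/-- Twice the mixed discriminant of two Hermitian forms. -/
noncomputable def mixedDiscr (Q R : ℂ × ℂ → ℝ) : ℝ :=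
  coeff11 Q * coeff22 R + coeff22 Q * coeff11 R - 2 * (coeffRe12 Q * coeffRe12 R)
    - 2 * (coeffIm12 Q * coeffIm12 R)

/-- For functions of class `C²` the Monge-Ampère current is computed pointwise. -/
theorem mongeAmpere_of_contDiffOn (hv : ContDiffOn ℝ 2 v Ω)
    (hpos : ∀ a, ∀ᵐ p ∂(volume.restrict (Ω : Set (ℂ × ℂ))), 0 ≤ leviForm v a p)
    (hlv : HasLeviMeasures Ω v) (φ : 𝓓(Ω, ℝ)) :
    Integrable (fun p => v p * mixedDiscr (fun a => leviForm v a p) fun b => leviForm φ b p) ∧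
    mongeAmpere Ω v φ =
      16 * ∫ p, v p * mixedDiscr (fun a => leviForm v a p) fun b => leviForm φ b p := by
  have e : ∀ a {ψ : ℂ × ℂ → ℝ}, Continuous ψ → tsupport ψ ⊆ tsupport φ →
      Integrable (fun p => leviForm v a p * (v p * ψ p)) ∧
      ∫ p, v p * ψ p ∂(leviMeasure Ω v a) = ∫ p, leviForm v a p * (v p * ψ p) := by
    intro a ψ hψ hψs
    have hψΩ := hψs.trans φ.tsupport_subset
    have hψc : HasCompactSupport ψ :=
      φ.hasCompactSupport.of_isClosed_subset (isClosed_tsupport _) hψs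
    have h1 := continuous_mul_of_continuousOn Ω.isOpen hv.continuousOn hψ hψΩ
    have h2 : HasCompactSupport fun p => v p * ψ p := hψc.mul_left
    have h3 : tsupport (fun p => v p * ψ p) ⊆ Ω := tsupport_mul_subset_right.trans hψΩ
    exact ⟨integrable_mul_of_continuousOn Ω.isOpen (continuousOn_leviForm Ω.isOpen hv a) h1 h3 h2 _,
      integral_leviMeasure_of_contDiffOn hv (hpos a) hlv h1 h2 h3⟩
  have i1 := fun a b => (e a (continuous_leviForm φ.contDiff_two b)
    (tsupport_leviForm_subset φ b)).1
  have i2 := fun a b c d => (e a (continuous_leviForm_comb φ b c d)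
    (tsupport_leviForm_comb_subset φ b c d)).1
  have f1 := fun a b => (e a (continuous_leviForm φ.contDiff_two b)
    (tsupport_leviForm_subset φ b)).2
  have f2 := fun a b c d => (e a (continuous_leviForm_comb φ b c d)
    (tsupport_leviForm_comb_subset φ b c d)).2
  -- The polarized coefficients of `v` are expanded, so that each term carries a single Levi form of
  -- `v` and matches one integral against a Levi measure.
  have split : ∀ p, v p * mixedDiscr (fun a => leviForm v a p) (fun b => leviForm φ b p) =
      leviForm v (1, 0) p * (v p * leviForm φ (0, 1) p)
      + leviForm v (0, 1) p * (v p * leviForm φ (1, 0) p)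
      - 2 * ((leviForm v (1, 1) p * (v p *
            ((leviForm φ (1, 1) p - leviForm φ (1, 0) p - leviForm φ (0, 1) p) / 2))
          - leviForm v (1, 0) p * (v p *
            ((leviForm φ (1, 1) p - leviForm φ (1, 0) p - leviForm φ (0, 1) p) / 2))
          - leviForm v (0, 1) p * (v p *
            ((leviForm φ (1, 1) p - leviForm φ (1, 0) p - leviForm φ (0, 1) p) / 2))) / 2)
      - 2 * ((leviForm v (1, Complex.I) p * (v p *
            ((leviForm φ (1, Complex.I) p - leviForm φ (1, 0) p - leviForm φ (0, 1) p) / 2))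
          - leviForm v (1, 0) p * (v p *
            ((leviForm φ (1, Complex.I) p - leviForm φ (1, 0) p - leviForm φ (0, 1) p) / 2))
          - leviForm v (0, 1) p * (v p *
            ((leviForm φ (1, Complex.I) p - leviForm φ (1, 0) p - leviForm φ (0, 1) p) / 2))) / 2) :=
    fun p => by
      simp only [mixedDiscr, coeff11, coeff22, coeffRe12, coeffIm12]
      ring
  simp only [split, mongeAmpere, coeff11, coeff22, coeffRe12, coeffIm12]
  have k := fun a b b' c c' d => integral_half_sub (i2 a b b' c) (i2 c' b b' c) (i2 d b b' c)
  have k1 := k (1, 1) (1, 1) (1, 0) (0, 1) (1, 0) (0, 1)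
  have k2 := k (1, Complex.I) (1, Complex.I) (1, 0) (0, 1) (1, 0) (0, 1)
  have k3 := integral_add_sub_sub (i1 (1, 0) (0, 1)) (i1 (0, 1) (1, 0)) k1.1 k2.1
  refine ⟨k3.1, ?_⟩
  rw [k3.2, k1.2, k2.2]
  simp only [f1, f2]

end MongeAmpere

/-! ### Product and chain rules for the Levi form -/

section Calculus

variable {f g : ℂ × ℂ → ℝ} {p : ℂ × ℂ}

/-- The real part of `∂_a f · conj (∂_a g)`, where `∂_a = ∑ a_j ∂/∂z_j`. -/
noncomputable def gradPair (f g : ℂ × ℂ → ℝ) (a p : ℂ × ℂ) : ℝ :=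
  (fderiv ℝ f p a * fderiv ℝ g p a
    + fderiv ℝ f p (Complex.I • a) * fderiv ℝ g p (Complex.I • a)) / 4

theorem differentiableAt_fderiv (hf : ContDiffAt ℝ 2 f p) : DifferentiableAt ℝ (fderiv ℝ f) p :=
  (hf.fderiv_right (m := 1) (by norm_num)).differentiableAt (by norm_num)

theorem leviForm_mul (hf : ContDiffAt ℝ 2 f p) (hg : ContDiffAt ℝ 2 g p) (a : ℂ × ℂ) :
    leviForm (fun q => f q * g q) a p
      = f p * leviForm g a p + g p * leviForm f a p + 2 * gradPair f g a p := by
  have h1 : fderiv ℝ (fun q => f q * g q) =ᶠ[𝓝 p]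
      fun q => f q • fderiv ℝ g q + g q • fderiv ℝ f q := by
    filter_upwards [hf.eventually (by simp), hg.eventually (by simp)] with q hq hq'
    exact fderiv_fun_mul (hq.differentiableAt (by norm_num)) (hq'.differentiableAt (by norm_num))
  have hf' := differentiableAt_fderiv hf
  have hg' := differentiableAt_fderiv hg
  have hf1 : DifferentiableAt ℝ f p := hf.differentiableAt (by norm_num)
  have hg1 : DifferentiableAt ℝ g p := hg.differentiableAt (by norm_num)
  simp only [leviForm, gradPair, h1.fderiv_eq]
  rw [fderiv_fun_add (hf1.fun_smul hg') (hg1.fun_smul hf'), fderiv_fun_smul hf1 hg',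
    fderiv_fun_smul hg1 hf']
  simp only [add_apply, smul_apply, ContinuousLinearMap.smulRight_apply, smul_eq_mul]
  ring

theorem fderiv_comp_apply {h : ℝ → ℝ} (hh : DifferentiableAt ℝ h (f p))
    (hf : DifferentiableAt ℝ f p) :
    fderiv ℝ (fun q => h (f q)) p = deriv h (f p) • fderiv ℝ f p :=
  (hh.hasDerivAt.comp_hasFDerivAt p hf.hasFDerivAt).fderiv

theorem leviForm_comp {h : ℝ → ℝ} (hh : ContDiffAt ℝ 2 h (f p)) (hf : ContDiffAt ℝ 2 f p)
    (a : ℂ × ℂ) :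
    leviForm (fun q => h (f q)) a p
      = deriv h (f p) * leviForm f a p + deriv (deriv h) (f p) * gradPair f f a p := by
  have h1 : fderiv ℝ (fun q => h (f q)) =ᶠ[𝓝 p] fun q => deriv h (f q) • fderiv ℝ f q := by
    filter_upwards [hf.eventually (by simp),
      hf.continuousAt.eventually (hh.eventually (by simp))] with q hq hq'
    exact fderiv_comp_apply (hq'.differentiableAt (by norm_num)) (hq.differentiableAt (by norm_num))
  have hf' := differentiableAt_fderiv hf
  have hf1 : DifferentiableAt ℝ f p := hf.differentiableAt (by norm_num)
  have hh' : DifferentiableAt ℝ (deriv h) (f p) :=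
    ((hh.fderiv_right (m := 1) (by norm_num)).clm_apply contDiffAt_const).differentiableAt
      (by norm_num)
  have hd : DifferentiableAt ℝ (fun q => deriv h (f q)) p := hh'.comp p hf1
  simp only [leviForm, gradPair, h1.fderiv_eq]
  rw [fderiv_fun_smul hd hf', fderiv_comp_apply hh' hf1]
  simp only [add_apply, smul_apply, ContinuousLinearMap.smulRight_apply, smul_eq_mul]
  ring

theorem gradPair_comp_left {h : ℝ → ℝ} (hh : DifferentiableAt ℝ h (f p))
    (hf : DifferentiableAt ℝ f p) (g : ℂ × ℂ → ℝ) (a : ℂ × ℂ) :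
    gradPair (fun q => h (f q)) g a p = deriv h (f p) * gradPair f g a p := by
  simp only [gradPair, fderiv_comp_apply hh hf, smul_apply, smul_eq_mul]
  ring

theorem gradPair_mul_left (hf : DifferentiableAt ℝ f p) (hg : DifferentiableAt ℝ g p)
    (k : ℂ × ℂ → ℝ) (a : ℂ × ℂ) :
    gradPair (fun q => f q * g q) k a p = f p * gradPair g k a p + g p * gradPair f k a p := by
  simp only [gradPair, fderiv_fun_mul hf hg, add_apply, smul_apply, smul_eq_mul]
  ring

theorem gradPair_comm (f g : ℂ × ℂ → ℝ) (a p : ℂ × ℂ) : gradPair f g a p = gradPair g f a p := by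
  simp only [gradPair]; ring

end Calculus

/-! ### Derivatives of $\log|z|$ and $\log|w|$ -/

section Log

variable {p : ℂ × ℂ}

theorem contDiffAt_log_norm_fst {n : WithTop ℕ∞} (hp : p.1 ≠ 0) :
    ContDiffAt ℝ n (fun q : ℂ × ℂ => Real.log ‖q.1‖) p :=
  (contDiffAt_fst.norm ℝ hp).log (norm_ne_zero_iff.2 hp)

theorem contDiffAt_log_norm_snd {n : WithTop ℕ∞} (hp : p.2 ≠ 0) :
    ContDiffAt ℝ n (fun q : ℂ × ℂ => Real.log ‖q.2‖) p :=
  (contDiffAt_snd.norm ℝ hp).log (norm_ne_zero_iff.2 hp)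

theorem hasFDerivAt_log_norm {z : ℂ} (hz : z ≠ 0) :
    HasFDerivAt (fun ζ : ℂ => Real.log ‖ζ‖)
      (Complex.reCLM ∘L (ContinuousLinearMap.toSpanSingleton ℂ z⁻¹).restrictScalars ℝ) z := by
  have h1 : HasFDerivAt (fun ζ : ℂ => ‖ζ‖ ^ 2) (2 • innerSL ℝ z) z :=
    (hasStrictFDerivAt_norm_sq z).hasFDerivAt
  -- $\log|\zeta|=\frac12\log|\zeta|^2$, and the squared norm is smooth.
  have h2 := (h1.log (by positivity)).const_mul (1 / 2 : ℝ)
  refine (h2.congr_of_eventuallyEq ?_).congr_fderiv ?_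
  · refine Eventually.of_forall fun ζ => ?_
    simp [Real.log_pow]
  · ext b
    have hz2 : ‖z‖ ^ 2 = z.re * z.re + z.im * z.im := by
      rw [← Complex.normSq_eq_norm_sq, Complex.normSq_apply]
    simp [Complex.inner, hz2, Complex.inv_re, Complex.inv_im, Complex.normSq_apply]
    ring

end Log

section LogNorm

variable {p : ℂ × ℂ}

theorem fderiv_log_norm_fst (hp : p.1 ≠ 0) (a : ℂ × ℂ) :
    fderiv ℝ (fun q : ℂ × ℂ => Real.log ‖q.1‖) p a = (a.1 / p.1).re := by
  have h : HasFDerivAt (fun q : ℂ × ℂ => Real.log ‖q.1‖) _ p :=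
    (hasFDerivAt_log_norm hp).comp p hasFDerivAt_fst
  rw [h.fderiv]
  simp [div_eq_mul_inv]

theorem fderiv_log_norm_snd (hp : p.2 ≠ 0) (a : ℂ × ℂ) :
    fderiv ℝ (fun q : ℂ × ℂ => Real.log ‖q.2‖) p a = (a.2 / p.2).re := by
  have h : HasFDerivAt (fun q : ℂ × ℂ => Real.log ‖q.2‖) _ p :=
    (hasFDerivAt_log_norm hp).comp p hasFDerivAt_snd
  rw [h.fderiv]
  simp [div_eq_mul_inv]

theorem fderiv_fderiv_log_norm_fst (hp : p.1 ≠ 0) (a : ℂ × ℂ) :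
    fderiv ℝ (fderiv ℝ fun q : ℂ × ℂ => Real.log ‖q.1‖) p a a = -((a.1 / p.1) ^ 2).re := by
  rw [← fderiv_fderiv_apply (contDiffAt_log_norm_fst hp)]
  have h1 : (fun q => fderiv ℝ (fun q : ℂ × ℂ => Real.log ‖q.1‖) q a) =ᶠ[𝓝 p]
      fun q => (a.1 * (q.1)⁻¹).re := by
    filter_upwards [continuousAt_fst.eventually_ne hp] with q hq
    rw [fderiv_log_norm_fst hq, div_eq_mul_inv]
  rw [h1.fderiv_eq]
  have h2 : HasFDerivAt (fun q : ℂ × ℂ => (q.1)⁻¹) _ p :=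
    ((hasDerivAt_inv hp).hasFDerivAt.restrictScalars ℝ).comp p hasFDerivAt_fst
  have h3 := Complex.reCLM.hasFDerivAt.comp p (h2.const_mul a.1)
  have h4 : HasFDerivAt (fun q : ℂ × ℂ => (a.1 * (q.1)⁻¹).re) _ p := h3
  rw [h4.fderiv]
  simp only [ContinuousLinearMap.comp_apply, smul_apply, ContinuousLinearMap.coe_restrictScalars',
    ContinuousLinearMap.toSpanSingleton_apply, ContinuousLinearMap.coe_fst', Complex.reCLM_apply,
    smul_eq_mul]
  rw [← Complex.neg_re]
  congr 1
  field_simp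

theorem fderiv_fderiv_log_norm_snd (hp : p.2 ≠ 0) (a : ℂ × ℂ) :
    fderiv ℝ (fderiv ℝ fun q : ℂ × ℂ => Real.log ‖q.2‖) p a a = -((a.2 / p.2) ^ 2).re := by
  rw [← fderiv_fderiv_apply (contDiffAt_log_norm_snd hp)]
  have h1 : (fun q => fderiv ℝ (fun q : ℂ × ℂ => Real.log ‖q.2‖) q a) =ᶠ[𝓝 p]
      fun q => (a.2 * (q.2)⁻¹).re := by
    filter_upwards [continuousAt_snd.eventually_ne hp] with q hq
    rw [fderiv_log_norm_snd hq, div_eq_mul_inv]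
  rw [h1.fderiv_eq]
  have h2 : HasFDerivAt (fun q : ℂ × ℂ => (q.2)⁻¹) _ p :=
    ((hasDerivAt_inv hp).hasFDerivAt.restrictScalars ℝ).comp p hasFDerivAt_snd
  have h3 := Complex.reCLM.hasFDerivAt.comp p (h2.const_mul a.2)
  have h4 : HasFDerivAt (fun q : ℂ × ℂ => (a.2 * (q.2)⁻¹).re) _ p := h3
  rw [h4.fderiv]
  simp only [ContinuousLinearMap.comp_apply, smul_apply, ContinuousLinearMap.coe_restrictScalars',
    ContinuousLinearMap.toSpanSingleton_apply, ContinuousLinearMap.coe_snd', Complex.reCLM_apply,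
    smul_eq_mul]
  rw [← Complex.neg_re]
  congr 1
  field_simp

/-- Pluriharmonicity: replacing `a` by `I • a` changes the sign of `(a.1 / p.1) ^ 2`, so the two
second derivatives cancel. -/
theorem leviForm_log_norm_fst (hp : p.1 ≠ 0) (a : ℂ × ℂ) :
    leviForm (fun q : ℂ × ℂ => Real.log ‖q.1‖) a p = 0 := by
  simp only [leviForm, fderiv_fderiv_log_norm_fst hp, Prod.smul_fst, smul_eq_mul, mul_div_assoc,
    mul_pow, Complex.I_sq]
  simp

theorem leviForm_log_norm_snd (hp : p.2 ≠ 0) (a : ℂ × ℂ) :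
    leviForm (fun q : ℂ × ℂ => Real.log ‖q.2‖) a p = 0 := by
  simp only [leviForm, fderiv_fderiv_log_norm_snd hp, Prod.smul_snd, smul_eq_mul, mul_div_assoc,
    mul_pow, Complex.I_sq]
  simp

/-- The real inner product of two complex numbers. -/
def reInner (A B : ℂ) : ℝ := A.re * B.re + A.im * B.im

theorem gradPair_fst_fst (hp : p.1 ≠ 0) (a : ℂ × ℂ) :
    gradPair (fun q : ℂ × ℂ => Real.log ‖q.1‖) (fun q => Real.log ‖q.1‖) a p
      = reInner (a.1 / p.1) (a.1 / p.1) / 4 := by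
  simp only [gradPair, fderiv_log_norm_fst hp, Prod.smul_fst, smul_eq_mul, mul_div_assoc,
    Complex.I_mul_re, reInner]
  ring

theorem gradPair_snd_snd (hp : p.2 ≠ 0) (a : ℂ × ℂ) :
    gradPair (fun q : ℂ × ℂ => Real.log ‖q.2‖) (fun q => Real.log ‖q.2‖) a p
      = reInner (a.2 / p.2) (a.2 / p.2) / 4 := by
  simp only [gradPair, fderiv_log_norm_snd hp, Prod.smul_snd, smul_eq_mul, mul_div_assoc,
    Complex.I_mul_re, reInner]
  ring

theorem gradPair_fst_snd (hp : p.1 ≠ 0) (hp' : p.2 ≠ 0) (a : ℂ × ℂ) :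
    gradPair (fun q : ℂ × ℂ => Real.log ‖q.1‖) (fun q => Real.log ‖q.2‖) a p
      = reInner (a.1 / p.1) (a.2 / p.2) / 4 := by
  simp only [gradPair, fderiv_log_norm_fst hp, fderiv_log_norm_snd hp', Prod.smul_fst,
    Prod.smul_snd, smul_eq_mul, mul_div_assoc, Complex.I_mul_re, reInner]
  ring

end LogNorm

/-! ### Functions of $u$ in logarithmic coordinates -/

section Blocki

/-- The function `-√(log |z| log |w|)` off the coordinate axes. -/
noncomputable def blockiReal (p : ℂ × ℂ) : ℝ := -√(Real.log ‖p.1‖ * Real.log ‖p.2‖)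

/-- The bidisc without the coordinate axes. -/
def toricBidisc : Set (ℂ × ℂ) :=
  {p | p.1 ≠ 0 ∧ ‖p.1‖ < 1 ∧ p.2 ≠ 0 ∧ ‖p.2‖ < 1}

theorem isOpen_toricBidisc : IsOpen toricBidisc :=
  (isOpen_ne_fun continuous_fst continuous_const).inter
    ((isOpen_lt continuous_fst.norm continuous_const).inter
      ((isOpen_ne_fun continuous_snd continuous_const).inter
        (isOpen_lt continuous_snd.norm continuous_const)))

variable {p : ℂ × ℂ}

theorem log_norm_fst_neg (hp : p ∈ toricBidisc) : Real.log ‖p.1‖ < 0 :=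
  Real.log_neg (norm_pos_iff.2 hp.1) hp.2.1

theorem log_norm_snd_neg (hp : p ∈ toricBidisc) : Real.log ‖p.2‖ < 0 :=
  Real.log_neg (norm_pos_iff.2 hp.2.2.1) hp.2.2.2

theorem log_mul_log_pos (hp : p ∈ toricBidisc) : 0 < Real.log ‖p.1‖ * Real.log ‖p.2‖ :=
  mul_pos_of_neg_of_neg (log_norm_fst_neg hp) (log_norm_snd_neg hp)

theorem blockiReal_neg (hp : p ∈ toricBidisc) : blockiReal p < 0 :=
  neg_lt_zero.2 (Real.sqrt_pos.2 (log_mul_log_pos hp))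

theorem blockiReal_mul_self (hp : p ∈ toricBidisc) :
    blockiReal p * blockiReal p = Real.log ‖p.1‖ * Real.log ‖p.2‖ := by
  rw [blockiReal, neg_mul_neg, Real.mul_self_sqrt (log_mul_log_pos hp).le]

theorem contDiffAt_blockiReal {n : WithTop ℕ∞} (hp : p ∈ toricBidisc) :
    ContDiffAt ℝ n blockiReal p :=
  (((contDiffAt_log_norm_fst hp.1).mul (contDiffAt_log_norm_snd hp.2.2.1)).sqrt
    (log_mul_log_pos hp).ne').neg

theorem blockiReal_mul_self_eventuallyEq (hp : p ∈ toricBidisc) :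
    (fun q => blockiReal q * blockiReal q) =ᶠ[𝓝 p]
      fun q => Real.log ‖q.1‖ * Real.log ‖q.2‖ := by
  filter_upwards [isOpen_toricBidisc.mem_nhds hp] with q hq
  exact blockiReal_mul_self hq

theorem gradPair_congr_left {f f' : ℂ × ℂ → ℝ} (h : f =ᶠ[𝓝 p] f') (k : ℂ × ℂ → ℝ) (a : ℂ × ℂ) :
    gradPair f k a p = gradPair f' k a p := by
  simp only [gradPair, h.fderiv_eq]

/-- Differentiating $u\cdot u=\log|z|\log|w|$ avoids differentiating the square root; first
derivatives of $u$ follow on division by $2u$. -/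
theorem two_mul_blockiReal_mul_gradPair (hp : p ∈ toricBidisc) (k : ℂ × ℂ → ℝ) (a : ℂ × ℂ) :
    2 * blockiReal p * gradPair blockiReal k a p
      = Real.log ‖p.1‖ * gradPair (fun q : ℂ × ℂ => Real.log ‖q.2‖) k a p
        + Real.log ‖p.2‖ * gradPair (fun q : ℂ × ℂ => Real.log ‖q.1‖) k a p := by
  have hT : DifferentiableAt ℝ blockiReal p :=
    (contDiffAt_blockiReal (n := 1) hp).differentiableAt (by norm_num)
  have h := gradPair_congr_left (blockiReal_mul_self_eventuallyEq hp) k a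
  rw [gradPair_mul_left hT hT, gradPair_mul_left
    ((contDiffAt_log_norm_fst (n := 1) hp.1).differentiableAt (by norm_num))
    ((contDiffAt_log_norm_snd (n := 1) hp.2.2.1).differentiableAt (by norm_num))] at h
  linarith

theorem gradPair_fst_blockiReal (hp : p ∈ toricBidisc) (a : ℂ × ℂ) :
    gradPair (fun q : ℂ × ℂ => Real.log ‖q.1‖) blockiReal a p
      = (Real.log ‖p.2‖ * reInner (a.1 / p.1) (a.1 / p.1)
        + Real.log ‖p.1‖ * reInner (a.1 / p.1) (a.2 / p.2)) / (8 * blockiReal p) := by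
  have ht := (blockiReal_neg hp).ne
  have h := two_mul_blockiReal_mul_gradPair hp (fun q : ℂ × ℂ => Real.log ‖q.1‖) a
  rw [gradPair_comm (fun q : ℂ × ℂ => Real.log ‖q.2‖), gradPair_fst_snd hp.1 hp.2.2.1,
    gradPair_fst_fst hp.1] at h
  rw [gradPair_comm, eq_div_iff (by simpa using ht)]
  linarith

theorem gradPair_snd_blockiReal (hp : p ∈ toricBidisc) (a : ℂ × ℂ) :
    gradPair (fun q : ℂ × ℂ => Real.log ‖q.2‖) blockiReal a p
      = (Real.log ‖p.1‖ * reInner (a.2 / p.2) (a.2 / p.2)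
        + Real.log ‖p.2‖ * reInner (a.1 / p.1) (a.2 / p.2)) / (8 * blockiReal p) := by
  have ht := (blockiReal_neg hp).ne
  have h := two_mul_blockiReal_mul_gradPair hp (fun q : ℂ × ℂ => Real.log ‖q.2‖) a
  rw [gradPair_fst_snd hp.1 hp.2.2.1, gradPair_snd_snd hp.2.2.1] at h
  rw [gradPair_comm, eq_div_iff (by simpa using ht)]
  linarith

theorem gradPair_blockiReal (hp : p ∈ toricBidisc) (a : ℂ × ℂ) :
    gradPair blockiReal blockiReal a p
      = (Real.log ‖p.2‖ ^ 2 * reInner (a.1 / p.1) (a.1 / p.1)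
        + 2 * (Real.log ‖p.1‖ * Real.log ‖p.2‖) * reInner (a.1 / p.1) (a.2 / p.2)
        + Real.log ‖p.1‖ ^ 2 * reInner (a.2 / p.2) (a.2 / p.2)) / (16 * blockiReal p ^ 2) := by
  have ht := (blockiReal_neg hp).ne
  have h := two_mul_blockiReal_mul_gradPair hp blockiReal a
  rw [gradPair_fst_blockiReal hp, gradPair_snd_blockiReal hp] at h
  field_simp at h ⊢
  linarith

theorem leviForm_blockiReal (hp : p ∈ toricBidisc) (a : ℂ × ℂ) :
    leviForm blockiReal a p
      = -(Real.log ‖p.2‖ ^ 2 * reInner (a.1 / p.1) (a.1 / p.1)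
        - 2 * (Real.log ‖p.1‖ * Real.log ‖p.2‖) * reInner (a.1 / p.1) (a.2 / p.2)
        + Real.log ‖p.1‖ ^ 2 * reInner (a.2 / p.2) (a.2 / p.2)) / (16 * blockiReal p ^ 3) := by
  have ht := (blockiReal_neg hp).ne
  -- The Levi form of $u^2$ is computed in two ways: as $2u$ times that of $u$ plus twice the
  -- gradient term, and as twice the mixed gradient term of two pluriharmonic logarithms.
  have h := leviForm_congr (blockiReal_mul_self_eventuallyEq hp) a
  rw [leviForm_mul (contDiffAt_blockiReal hp) (contDiffAt_blockiReal hp), leviForm_mul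
    (contDiffAt_log_norm_fst hp.1) (contDiffAt_log_norm_snd hp.2.2.1), leviForm_log_norm_fst hp.1,
    leviForm_log_norm_snd hp.2.2.1, gradPair_fst_snd hp.1 hp.2.2.1, gradPair_blockiReal hp] at h
  rw [eq_div_iff (by positivity)]
  have ht2 := blockiReal_mul_self hp
  generalize leviForm blockiReal a p = L at *
  generalize blockiReal p = t at *
  field_simp at h
  linear_combination h / 8 + 4 * reInner (a.1 / p.1) (a.2 / p.2) * ht2

/-- The Hermitian form with the coefficients `P`, `R`, `S` in logarithmic coordinates at `p`. -/
noncomputable def logForm (p : ℂ × ℂ) (P R S : ℝ) (a : ℂ × ℂ) : ℝ :=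
  (P * reInner (a.1 / p.1) (a.1 / p.1) + 2 * R * reInner (a.1 / p.1) (a.2 / p.2)
    + S * reInner (a.2 / p.2) (a.2 / p.2)) / 4

/-- Passing from $a$ to $(a_1/z,a_2/w)$ scales the discriminant by $|z|^{-2}|w|^{-2}$ and leaves two
real symmetric matrices, each divided by $4$. On the axes both sides vanish, as division by zero
gives zero. -/
theorem mixedDiscr_logForm (p : ℂ × ℂ) (P R S P' R' S' : ℝ) :
    mixedDiscr (logForm p P R S) (logForm p P' R' S')
      = (P * S' + S * P' - 2 * R * R') / (16 * (‖p.1‖ ^ 2 * ‖p.2‖ ^ 2)) := by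
  have e1 : ‖p.1‖ ^ 2 = (reInner (1 / p.1) (1 / p.1))⁻¹ := by
    rw [← Complex.normSq_eq_norm_sq]
    have : reInner (1 / p.1) (1 / p.1) = Complex.normSq (1 / p.1) := by
      rw [Complex.normSq_apply, reInner]
    rw [this]; simp
  have e2 : ‖p.2‖ ^ 2 = (reInner (1 / p.2) (1 / p.2))⁻¹ := by
    rw [← Complex.normSq_eq_norm_sq]
    have : reInner (1 / p.2) (1 / p.2) = Complex.normSq (1 / p.2) := by
      rw [Complex.normSq_apply, reInner]
    rw [this]; simp
  rw [e1, e2, ← mul_inv, div_eq_mul_inv, mul_inv, inv_inv]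
  have e3 : Complex.I / p.2 = Complex.I * (1 / p.2) := by rw [mul_one_div]
  simp only [mixedDiscr, logForm, coeff11, coeff22, coeffRe12, coeffIm12, e3, zero_div]
  generalize (1 / p.1) = A
  generalize (1 / p.2) = B
  simp only [reInner, Complex.I_mul_re, Complex.I_mul_im, Complex.zero_re, Complex.zero_im]
  ring

/-- The three coefficients are the real Hessian of $g(-\sqrt{xy})$ in $x,y$. Its determinant is a
multiple of $g'g''$: the part with $g'$ alone is degenerate, which is $(dd^cu)^2=0$. -/
theorem leviForm_comp_blockiReal (hp : p ∈ toricBidisc) {g : ℝ → ℝ}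
    (hg : ContDiffAt ℝ 2 g (blockiReal p)) (a : ℂ × ℂ) :
    leviForm (fun q => g (blockiReal q)) a p
      = logForm p
        (Real.log ‖p.2‖ ^ 2 * (deriv (deriv g) (blockiReal p) / (4 * blockiReal p ^ 2)
          - deriv g (blockiReal p) / (4 * blockiReal p ^ 3)))
        ((Real.log ‖p.1‖ * Real.log ‖p.2‖) * (deriv (deriv g) (blockiReal p)
          / (4 * blockiReal p ^ 2) + deriv g (blockiReal p) / (4 * blockiReal p ^ 3)))
        (Real.log ‖p.1‖ ^ 2 * (deriv (deriv g) (blockiReal p) / (4 * blockiReal p ^ 2)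
          - deriv g (blockiReal p) / (4 * blockiReal p ^ 3))) a := by
  rw [leviForm_comp hg (contDiffAt_blockiReal hp), leviForm_blockiReal hp, gradPair_blockiReal hp,
    logForm]
  have ht := (blockiReal_neg hp).ne
  field_simp
  ring

theorem leviForm_comp_blockiReal_nonneg (hp : p ∈ toricBidisc) {g : ℝ → ℝ}
    (hg : ContDiffAt ℝ 2 g (blockiReal p)) (h1 : 0 ≤ deriv g (blockiReal p))
    (h2 : 0 ≤ deriv (deriv g) (blockiReal p)) (a : ℂ × ℂ) :
    0 ≤ leviForm (fun q => g (blockiReal q)) a p := by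
  rw [leviForm_comp hg (contDiffAt_blockiReal hp), leviForm_blockiReal hp]
  have ht := blockiReal_neg hp
  have h3 : 0 ≤ gradPair blockiReal blockiReal a p := by
    exact div_nonneg (add_nonneg (mul_self_nonneg _) (mul_self_nonneg _)) (by norm_num)
  refine add_nonneg (mul_nonneg h1 (div_nonneg_of_nonpos ?_ ?_)) (mul_nonneg h2 h3)
  -- Up to sign the numerator is $|\log|w|\,a_1/z-\log|z|\,a_2/w|^2$, and $u^3<0$.
  · simp only [reInner]
    generalize (a.1 / p.1) = A
    generalize (a.2 / p.2) = B
    nlinarith [sq_nonneg (Real.log ‖p.2‖ * A.re - Real.log ‖p.1‖ * B.re),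
      sq_nonneg (Real.log ‖p.2‖ * A.im - Real.log ‖p.1‖ * B.im)]
  · have : blockiReal p ^ 3 < 0 := Odd.pow_neg (by decide) ht
    linarith

/-- Since $\alpha$ depends on $x$ only, its derivatives enter the $xx$ and $xy$ coefficients but not
the $yy$ one. -/
theorem leviForm_mul_comp_blockiReal (hp : p ∈ toricBidisc) {α B : ℝ → ℝ}
    (hα : ContDiff ℝ 2 α) (hB : ContDiff ℝ 2 B) (a : ℂ × ℂ) :
    leviForm (fun q => α (Real.log ‖q.1‖) * B (blockiReal q)) a p
      = logForm p
        (α (Real.log ‖p.1‖) * (Real.log ‖p.2‖ ^ 2 * (deriv (deriv B) (blockiReal p)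
            / (4 * blockiReal p ^ 2) - deriv B (blockiReal p) / (4 * blockiReal p ^ 3)))
          + B (blockiReal p) * deriv (deriv α) (Real.log ‖p.1‖)
          + deriv α (Real.log ‖p.1‖) * deriv B (blockiReal p) * Real.log ‖p.2‖ / blockiReal p)
        (α (Real.log ‖p.1‖) * ((Real.log ‖p.1‖ * Real.log ‖p.2‖) * (deriv (deriv B) (blockiReal p)
          / (4 * blockiReal p ^ 2) + deriv B (blockiReal p) / (4 * blockiReal p ^ 3)))
          + deriv α (Real.log ‖p.1‖) * deriv B (blockiReal p) * Real.log ‖p.1‖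
            / (2 * blockiReal p))
        (α (Real.log ‖p.1‖) * (Real.log ‖p.1‖ ^ 2 * (deriv (deriv B) (blockiReal p)
          / (4 * blockiReal p ^ 2) - deriv B (blockiReal p) / (4 * blockiReal p ^ 3)))) a := by
  have hX : ContDiffAt ℝ 2 (fun q : ℂ × ℂ => Real.log ‖q.1‖) p := contDiffAt_log_norm_fst hp.1
  have hT : ContDiffAt ℝ 2 blockiReal p := contDiffAt_blockiReal hp
  have hX1 := hX.differentiableAt (by norm_num)
  have hT1 := hT.differentiableAt (by norm_num)
  have hα1 : DifferentiableAt ℝ α (Real.log ‖p.1‖) := hα.contDiffAt.differentiableAt (by norm_num)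
  have hB1 : DifferentiableAt ℝ B (blockiReal p) := hB.contDiffAt.differentiableAt (by norm_num)
  rw [leviForm_mul (f := fun q : ℂ × ℂ => α (Real.log ‖q.1‖)) (g := fun q => B (blockiReal q))
      (hα.contDiffAt.comp p hX) (hB.contDiffAt.comp p hT),
    leviForm_comp_blockiReal hp hB.contDiffAt, leviForm_comp hα.contDiffAt hX,
    leviForm_log_norm_fst hp.1, gradPair_fst_fst hp.1,
    gradPair_comp_left (f := fun q : ℂ × ℂ => Real.log ‖q.1‖) hα1 hX1, gradPair_comm,
    gradPair_comp_left hB1 hT1, gradPair_comm, gradPair_fst_blockiReal hp]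
  have ht := (blockiReal_neg hp).ne
  simp only [logForm]
  field_simp
  ring

/-- The density of the Monge-Ampère pairing, in the coordinates `x = log |z|` and
`t = -√(log |z| log |w|)`. -/
noncomputable def toricDensity (g α B : ℝ → ℝ) (x t : ℝ) : ℝ :=
  g t * (-(α x) * (deriv (deriv g) t * deriv B t + deriv g t * deriv (deriv B) t) / (4 * t)
    + x ^ 2 * B t * deriv (deriv α) x * (deriv (deriv g) t / (4 * t ^ 2)
      - deriv g t / (4 * t ^ 3))
    - x * deriv α x * deriv B t * deriv g t / (2 * t ^ 2))

theorem mixedDiscr_comp_blockiReal (hp : p ∈ toricBidisc) {g α B : ℝ → ℝ}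
    (hg : ContDiffAt ℝ 2 g (blockiReal p)) (hα : ContDiff ℝ 2 α) (hB : ContDiff ℝ 2 B) :
    16 * (g (blockiReal p) * mixedDiscr (fun a => leviForm (fun q => g (blockiReal q)) a p)
        (fun a => leviForm (fun q => α (Real.log ‖q.1‖) * B (blockiReal q)) a p))
      = toricDensity g α B (Real.log ‖p.1‖) (blockiReal p) / (‖p.1‖ ^ 2 * ‖p.2‖ ^ 2) := by
  simp only [leviForm_comp_blockiReal hp hg, leviForm_mul_comp_blockiReal hp hα hB]
  have ht := (blockiReal_neg hp).ne
  have hx := (log_norm_fst_neg hp).ne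
  -- $y=t^2/x$ eliminates $y$, leaving a function of $(x,t)$.
  have hy : Real.log ‖p.2‖ = blockiReal p ^ 2 / Real.log ‖p.1‖ := by
    rw [eq_div_iff hx, pow_two, blockiReal_mul_self hp, mul_comm]
  have hz : ‖p.1‖ ≠ 0 := norm_ne_zero_iff.2 hp.1
  have hw : ‖p.2‖ ≠ 0 := norm_ne_zero_iff.2 hp.2.2.1
  refine (congrArg (fun s => 16 * (g (blockiReal p) * s))
    (mixedDiscr_logForm p _ _ _ _ _ _)).trans ?_
  rw [toricDensity, hy]
  field_simp
  ring

end Blocki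

/-! ### Extension across the axes -/

section ToricExt

/-- The function `g (-√(log |z| log |w|))`, with the value `c` on the coordinate axes. -/
noncomputable def toricExt (g : ℝ → ℝ) (c : ℝ) (p : ℂ × ℂ) : ℝ :=
  open Classical in if p.1 = 0 ∨ p.2 = 0 then c else g (blockiReal p)

theorem toricExt_of_axis {p : ℂ × ℂ} (hp : p.1 = 0 ∨ p.2 = 0) (g : ℝ → ℝ) (c : ℝ) :
    toricExt g c p = c := if_pos hp

theorem toricExt_of_ne {p : ℂ × ℂ} (hp : ¬(p.1 = 0 ∨ p.2 = 0)) (g : ℝ → ℝ) (c : ℝ) :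
    toricExt g c p = g (blockiReal p) := if_neg hp

theorem extendBot_blockiFun (χ : ℝ → ℝ) (p : ℂ × ℂ) :
    extendBot χ (blockiFun p) = toricExt χ (sInf (χ '' Set.Iio 0)) p := by
  by_cases hp : p.1 = 0 ∨ p.2 = 0
  · rw [toricExt_of_axis hp, blockiFun, if_pos hp, extendBot, if_pos rfl]
  · rw [toricExt_of_ne hp, blockiFun, if_neg hp, extendBot, if_neg (EReal.coe_ne_bot _),
      EReal.toReal_coe, blockiReal]

theorem mem_puncturedBidisc {p : ℂ × ℂ} :
    p ∈ puncturedBidisc ↔ (‖p.1‖ < 1 ∧ ‖p.2‖ < 1) ∧ p ≠ 0 := by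
  change (p.1 ∈ Metric.ball (0 : ℂ) 1 ∧ p.2 ∈ Metric.ball (0 : ℂ) 1) ∧ p ≠ 0 ↔ _
  simp

theorem toricBidisc_subset {p : ℂ × ℂ} (hp : p ∈ toricBidisc) : p ∈ puncturedBidisc :=
  mem_puncturedBidisc.2 ⟨⟨hp.2.1, hp.2.2.2⟩, fun h => hp.1 (by rw [h]; rfl)⟩

theorem mem_toricBidisc {p : ℂ × ℂ} (hp : p ∈ puncturedBidisc) (h : ¬(p.1 = 0 ∨ p.2 = 0)) :
    p ∈ toricBidisc := by
  rw [mem_puncturedBidisc] at hp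
  push Not at h
  exact ⟨h.1, hp.1.1, h.2, hp.1.2⟩

theorem toricExt_eventuallyEq {p : ℂ × ℂ} (hp : p ∈ toricBidisc) (g : ℝ → ℝ) (c : ℝ) :
    toricExt g c =ᶠ[𝓝 p] fun q => g (blockiReal q) := by
  filter_upwards [isOpen_toricBidisc.mem_nhds hp] with q hq
  exact toricExt_of_ne (not_or.2 ⟨hq.1, hq.2.2.1⟩) g c

theorem neg_sqrt_mul_le {x y δ T : ℝ} (hδ : 0 < δ) (hx : x ≤ -δ)
    (hy : y ≤ -(T ^ 2 / δ)) : -√(x * y) ≤ T := by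
  have h : T ^ 2 ≤ x * y := by
    have h1 : δ * (T ^ 2 / δ) = T ^ 2 := by field_simp
    have h2 : 0 ≤ T ^ 2 / δ := by positivity
    nlinarith
  have := Real.le_sqrt_of_sq_le (x := -T) (y := x * y) (by rwa [neg_sq])
  linarith

theorem eventually_log_norm_le (C : ℝ) : ∀ᶠ ζ : ℂ in 𝓝 0, ζ = 0 ∨ Real.log ‖ζ‖ ≤ C := by
  filter_upwards [Metric.ball_mem_nhds (0 : ℂ) (Real.exp_pos C)] with ζ hζ
  rcases eq_or_ne ζ 0 with h | h
  · exact Or.inl h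
  · refine Or.inr ((Real.log_le_iff_le_exp (norm_pos_iff.2 h)).2 ?_)
    simpa using (mem_ball_zero_iff.1 hζ).le

theorem eventually_log_norm_le_half {z : ℂ} (hz : z ≠ 0) (hz1 : ‖z‖ < 1) :
    ∀ᶠ ζ : ℂ in 𝓝 z, Real.log ‖ζ‖ ≤ -(-Real.log ‖z‖ / 2) := by
  have hc : ContinuousAt (fun ζ : ℂ => Real.log ‖ζ‖) z :=
    continuous_norm.continuousAt.log (norm_ne_zero_iff.2 hz)
  have hneg := Real.log_neg (norm_pos_iff.2 hz) hz1
  filter_upwards [hc.eventually_lt continuousAt_const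
    (show Real.log ‖z‖ < -(-Real.log ‖z‖ / 2) by linarith)] with ζ hζ using hζ.le

/-- At an axis point of $\Omega$ one logarithm tends to $-\infty$ and the other stays below a
negative constant, so $u\to-\infty$. -/
theorem eventually_blockiReal_le {p : ℂ × ℂ} (hp : p ∈ puncturedBidisc)
    (h : p.1 = 0 ∨ p.2 = 0) (T : ℝ) :
    ∀ᶠ q in 𝓝 p, (q.1 = 0 ∨ q.2 = 0) ∨ blockiReal q ≤ T := by
  obtain ⟨⟨h1, h2⟩, h0⟩ := mem_puncturedBidisc.1 hp
  rcases h with h | h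
  · have hw : p.2 ≠ 0 := fun h' => h0 (Prod.ext h h')
    have hδ : 0 < -Real.log ‖p.2‖ / 2 := by
      linarith [Real.log_neg (norm_pos_iff.2 hw) h2]
    have e1 := continuousAt_snd.eventually (eventually_log_norm_le_half hw h2)
    have e2 := (continuousAt_fst (p := p)).eventually
      (p := fun ζ : ℂ => ζ = 0 ∨ Real.log ‖ζ‖ ≤ -(T ^ 2 / (-Real.log ‖p.2‖ / 2)))
      (by rw [h]; exact eventually_log_norm_le _)
    filter_upwards [e1, e2] with q hq1 hq2
    rcases hq2 with hq2 | hq2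
    · exact Or.inl (Or.inl hq2)
    · refine Or.inr ?_
      rw [blockiReal, mul_comm]
      exact neg_sqrt_mul_le hδ hq1 hq2
  · have hz : p.1 ≠ 0 := fun h' => h0 (Prod.ext h' h)
    have hδ : 0 < -Real.log ‖p.1‖ / 2 := by
      linarith [Real.log_neg (norm_pos_iff.2 hz) h1]
    have e1 := continuousAt_fst.eventually (eventually_log_norm_le_half hz h1)
    have e2 := (continuousAt_snd (p := p)).eventually
      (p := fun ζ : ℂ => ζ = 0 ∨ Real.log ‖ζ‖ ≤ -(T ^ 2 / (-Real.log ‖p.1‖ / 2)))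
      (by rw [h]; exact eventually_log_norm_le _)
    filter_upwards [e1, e2] with q hq1 hq2
    rcases hq2 with hq2 | hq2
    · exact Or.inl (Or.inr hq2)
    · exact Or.inr (neg_sqrt_mul_le hδ hq1 hq2)

/-- Near an axis point $u\le T$, so the extension is locally constant there. This is why the
approximants of $\chi$ are made constant near $-\infty$. -/
theorem contDiffOn_toricExt {n : WithTop ℕ∞} {g : ℝ → ℝ} (hg : ContDiff ℝ n g) {c T : ℝ}
    (hc : ∀ t ≤ T, g t = c) : ContDiffOn ℝ n (toricExt g c) puncturedBidisc := by
  intro p hp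
  refine ContDiffAt.contDiffWithinAt ?_
  by_cases h : p.1 = 0 ∨ p.2 = 0
  · have e : toricExt g c =ᶠ[𝓝 p] fun _ => c := by
      filter_upwards [eventually_blockiReal_le hp h T] with q hq
      by_cases hq' : q.1 = 0 ∨ q.2 = 0
      · exact toricExt_of_axis hq' g c
      · rw [toricExt_of_ne hq', hc _ (hq.resolve_left hq')]
    exact contDiffAt_const.congr_of_eventuallyEq e
  · have hp' := mem_toricBidisc hp h
    exact (hg.contDiffAt.comp p (contDiffAt_blockiReal hp')).congr_of_eventuallyEq
      (toricExt_eventuallyEq hp' g c)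

theorem ae_notMem_axes : ∀ᵐ p : ℂ × ℂ, ¬(p.1 = 0 ∨ p.2 = 0) := by
  have h1 : ∀ᵐ p : ℂ × ℂ, p.1 ≠ 0 :=
    Measure.quasiMeasurePreserving_fst.ae (p := fun z : ℂ => z ≠ 0) (by simp [ae_iff])
  have h2 : ∀ᵐ p : ℂ × ℂ, p.2 ≠ 0 :=
    Measure.quasiMeasurePreserving_snd.ae (p := fun z : ℂ => z ≠ 0) (by simp [ae_iff])
  filter_upwards [h1, h2] with p h1 h2
  exact not_or.2 ⟨h1, h2⟩

theorem leviForm_toricExt_nonneg {g : ℝ → ℝ} (hg : ContDiff ℝ 2 g) (c : ℝ)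
    (h1 : ∀ t < 0, 0 ≤ deriv g t) (h2 : ∀ t < 0, 0 ≤ deriv (deriv g) t) (a : ℂ × ℂ) :
    ∀ᵐ p ∂(volume.restrict (puncturedBidisc : Set (ℂ × ℂ))), 0 ≤ leviForm (toricExt g c) a p := by
  rw [ae_restrict_iff' puncturedBidisc.isOpen.measurableSet]
  filter_upwards [ae_notMem_axes] with p hp hpΩ
  have hp' := mem_toricBidisc hpΩ hp
  rw [leviForm_congr (toricExt_eventuallyEq hp' g c)]
  exact leviForm_comp_blockiReal_nonneg hp' hg.contDiffAt (h1 _ (blockiReal_neg hp'))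
    (h2 _ (blockiReal_neg hp')) a

end ToricExt

/-! ### The test function -/

section Test

variable {α B : ℝ → ℝ}

/-- A compact subset of the punctured bidisc that meets the axis `w = 0`. -/
def toricCompact : Set (ℂ × ℂ) :=
  {p | Real.exp (-3) ≤ ‖p.1‖ ∧ ‖p.1‖ ≤ Real.exp (-1) ∧ ‖p.2‖ ≤ Real.exp (-(1 / 3))}

theorem isCompact_toricCompact : IsCompact toricCompact := by
  refine Metric.isCompact_of_isClosed_isBounded ?_ ?_
  · exact (isClosed_le continuous_const continuous_fst.norm).inter
      ((isClosed_le continuous_fst.norm continuous_const).inter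
        (isClosed_le continuous_snd.norm continuous_const))
  · refine (Metric.isBounded_closedBall (x := (0 : ℂ × ℂ)) (r := 1)).subset fun p hp => ?_
    rw [mem_closedBall_zero_iff, Prod.norm_def]
    exact max_le (hp.2.1.trans (Real.exp_le_one_iff.2 (by norm_num)))
      (hp.2.2.trans (Real.exp_le_one_iff.2 (by norm_num)))

theorem fst_ne_zero_of_mem_toricCompact {p : ℂ × ℂ} (hp : p ∈ toricCompact) : p.1 ≠ 0 :=
  norm_pos_iff.1 ((Real.exp_pos _).trans_le hp.1)

theorem toricCompact_subset : toricCompact ⊆ puncturedBidisc := fun p hp =>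
  mem_puncturedBidisc.2 ⟨⟨hp.2.1.trans_lt (Real.exp_lt_one_iff.2 (by norm_num)),
    hp.2.2.trans_lt (Real.exp_lt_one_iff.2 (by norm_num))⟩,
    fun h => fst_ne_zero_of_mem_toricCompact hp (by rw [h]; rfl)⟩

theorem mem_toricCompact (hα : ∀ x, α x ≠ 0 → -3 < x ∧ x < -1) (hB : ∀ t, -1 ≤ t → B t = 0)
    {p : ℂ × ℂ} (hp : α (Real.log ‖p.1‖) * toricExt B 1 p ≠ 0) : p ∈ toricCompact := by
  obtain ⟨h1, h2⟩ := hα _ (left_ne_zero_of_mul hp)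
  -- `Real.log 0 = 0` lies outside the interval $(-3,-1)$.
  have hz : p.1 ≠ 0 := fun h => by
    rw [h] at h2; norm_num at h2
  have hz' := norm_pos_iff.2 hz
  refine ⟨((Real.lt_log_iff_exp_lt hz').1 h1).le, ((Real.log_lt_iff_lt_exp hz').1 h2).le, ?_⟩
  by_cases hw : p.2 = 0
  · rw [hw, norm_zero]
    positivity
  · have hB' := right_ne_zero_of_mul hp
    rw [toricExt_of_ne (not_or.2 ⟨hz, hw⟩)] at hB'
    -- $xy>1$ together with $-3<x<0$ forces $y<-1/3$, the exponent in `toricCompact`.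
    have ht : blockiReal p < -1 := lt_of_not_ge fun h => hB' (hB _ h)
    rw [blockiReal, neg_lt_neg_iff, Real.lt_sqrt (by norm_num)] at ht
    rw [← Real.log_le_iff_le_exp (norm_pos_iff.2 hw)]
    by_contra h
    push Not at h
    nlinarith

/-- The test function `α (log |z|) B (-√(log |z| log |w|))`. -/
noncomputable def toricTest (hα : ContDiff ℝ ∞ α) (hα0 : ∀ x, α x ≠ 0 → -3 < x ∧ x < -1)
    (hB : ContDiff ℝ ∞ B) (hB0 : ∀ t, -1 ≤ t → B t = 0) (hB1 : ∀ t ≤ -2, B t = 1) :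
    𝓓(puncturedBidisc, ℝ) :=
  have hsub : tsupport (fun p : ℂ × ℂ => α (Real.log ‖p.1‖) * toricExt B 1 p) ⊆ toricCompact :=
    closure_minimal (fun _ hp => mem_toricCompact hα0 hB0 hp) isCompact_toricCompact.isClosed
  { toFun := fun p => α (Real.log ‖p.1‖) * toricExt B 1 p
    contDiff' := by
      rw [contDiff_iff_contDiffAt]
      intro p
      by_cases hp : p ∈ tsupport fun p : ℂ × ℂ => α (Real.log ‖p.1‖) * toricExt B 1 p
      · have hK := hsub hp
        have hΩ := toricCompact_subset hK
        exact (hα.contDiffAt.comp p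
          (contDiffAt_log_norm_fst (fst_ne_zero_of_mem_toricCompact hK))).mul
          ((contDiffOn_toricExt hB hB1).contDiffAt
            (puncturedBidisc.isOpen.mem_nhds hΩ))
      · exact contDiffAt_const.congr_of_eventuallyEq (notMem_tsupport_iff_eventuallyEq.1 hp)
    hasCompactSupport' := isCompact_toricCompact.of_isClosed_subset (isClosed_tsupport _) hsub
    tsupport_subset' := hsub.trans toricCompact_subset }

theorem toricTest_apply (hα : ContDiff ℝ ∞ α) (hα0 : ∀ x, α x ≠ 0 → -3 < x ∧ x < -1)
    (hB : ContDiff ℝ ∞ B) (hB0 : ∀ t, -1 ≤ t → B t = 0) (hB1 : ∀ t ≤ -2, B t = 1) (p : ℂ × ℂ) :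
    toricTest hα hα0 hB hB0 hB1 p = α (Real.log ‖p.1‖) * toricExt B 1 p := rfl

end Test

theorem mixedDiscr_zero_right (Q : ℂ × ℂ → ℝ) : mixedDiscr Q (fun _ => 0) = 0 := by
  simp [mixedDiscr, coeff11, coeff22, coeffRe12, coeffIm12]

theorem measurableSet_toricBidisc : MeasurableSet toricBidisc := isOpen_toricBidisc.measurableSet

theorem mongeAmpere_toricExt {α B g : ℝ → ℝ} (hα : ContDiff ℝ ∞ α)
    (hα0 : ∀ x, α x ≠ 0 → -3 < x ∧ x < -1)
    (hB : ContDiff ℝ ∞ B) (hB0 : ∀ t, -1 ≤ t → B t = 0) (hB1 : ∀ t ≤ -2, B t = 1)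
    (hg : ContDiff ℝ 2 g) {c T : ℝ} (hc : ∀ t ≤ T, g t = c)
    (h1 : ∀ t < 0, 0 ≤ deriv g t) (h2 : ∀ t < 0, 0 ≤ deriv (deriv g) t)
    (hl : HasLeviMeasures puncturedBidisc (toricExt g c)) :
    IntegrableOn (fun p => toricDensity g α B (Real.log ‖p.1‖) (blockiReal p)
      / (‖p.1‖ ^ 2 * ‖p.2‖ ^ 2)) toricBidisc ∧
    mongeAmpere puncturedBidisc (toricExt g c) (toricTest hα hα0 hB hB0 hB1)
      = ∫ p in toricBidisc, toricDensity g α B (Real.log ‖p.1‖) (blockiReal p)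
        / (‖p.1‖ ^ 2 * ‖p.2‖ ^ 2) := by
  set φ := toricTest hα hα0 hB hB0 hB1 with hφ
  obtain ⟨hi, he⟩ := mongeAmpere_of_contDiffOn (contDiffOn_toricExt hg hc)
    (leviForm_toricExt_nonneg hg c h1 h2) hl φ
  -- The axes are a null set, and outside `Ω` the test function has zero Levi form; hence only
  -- `toricBidisc` contributes.
  have hae : (fun p => 16 * (toricExt g c p * mixedDiscr (fun a => leviForm (toricExt g c) a p)
      fun b => leviForm φ b p)) =ᵐ[volume] toricBidisc.indicator fun p =>
        toricDensity g α B (Real.log ‖p.1‖) (blockiReal p) / (‖p.1‖ ^ 2 * ‖p.2‖ ^ 2) := by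
    filter_upwards [ae_notMem_axes] with p hp
    by_cases hpΩ : p ∈ puncturedBidisc
    · have hp' := mem_toricBidisc hpΩ hp
      have hφe : φ =ᶠ[𝓝 p] fun q => α (Real.log ‖q.1‖) * B (blockiReal q) := by
        filter_upwards [toricExt_eventuallyEq hp' B 1] with q hq
        rw [hφ, toricTest_apply, hq]
      rw [Set.indicator_of_mem hp', ← mixedDiscr_comp_blockiReal hp' hg.contDiffAt
        (hα.of_le (WithTop.coe_le_coe.2 le_top)) (hB.of_le (WithTop.coe_le_coe.2 le_top))]
      simp only [leviForm_congr (toricExt_eventuallyEq hp' g c), leviForm_congr hφe,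
        toricExt_of_ne hp]
    · have h0 : ∀ b, leviForm φ b p = 0 := fun b =>
        leviForm_eq_zero_of_notMem_tsupport (fun h => hpΩ (φ.tsupport_subset h)) b
      rw [Set.indicator_of_notMem fun h => hpΩ (toricBidisc_subset h)]
      simp only [h0, mixedDiscr_zero_right, mul_zero]
  refine ⟨(integrable_indicator_iff measurableSet_toricBidisc).1 ((hi.const_mul 16).congr hae), ?_⟩
  rw [he, ← integral_const_mul, integral_congr_ae hae, integral_indicator measurableSet_toricBidisc]

/-! ### Polar and logarithmic coordinates -/

section Radial

/-- The punctured unit disc. -/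
def puncturedDisc : Set ℂ := {z | z ≠ 0 ∧ ‖z‖ < 1}

theorem measurableSet_puncturedDisc : MeasurableSet puncturedDisc :=
  ((isOpen_ne_fun continuous_id continuous_const).inter
    (isOpen_lt continuous_norm continuous_const)).measurableSet

theorem toricBidisc_eq_prod : toricBidisc = puncturedDisc ×ˢ puncturedDisc := by
  ext p
  exact ⟨fun h => ⟨⟨h.1, h.2.1⟩, h.2.2⟩, fun h => ⟨h.1.1, h.1.2, h.2⟩⟩

/-- Integration of a radial function in the logarithmic coordinate. -/
theorem setIntegral_puncturedDisc (h : ℝ → ℝ) :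
    ∫ z in puncturedDisc, h (Real.log ‖z‖) / ‖z‖ ^ 2
      = 2 * Real.pi * ∫ y in Set.Iio 0, h y := by
  have e1 : ∫ z in puncturedDisc, h (Real.log ‖z‖) / ‖z‖ ^ 2
      = ∫ z : ℂ, (Set.Ioo (0 : ℝ) 1).indicator (fun s => h (Real.log s) / s ^ 2) ‖z‖ := by
    rw [← integral_indicator measurableSet_puncturedDisc]
    congr 1 with z
    by_cases hz : z ∈ puncturedDisc
    · have hz' : ‖z‖ ∈ Set.Ioo (0 : ℝ) 1 := ⟨norm_pos_iff.2 hz.1, hz.2⟩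
      rw [Set.indicator_of_mem hz, Set.indicator_of_mem hz']
    · rw [Set.indicator_of_notMem hz, Set.indicator_of_notMem]
      exact fun h' => hz ⟨norm_pos_iff.1 h'.1, h'.2⟩
  have e2 : Set.Ioo (0 : ℝ) 1 = Real.exp '' Set.Iio 0 := by
    ext s
    constructor
    · exact fun hs => ⟨Real.log s, Real.log_neg hs.1 hs.2, Real.exp_log hs.1⟩
    · rintro ⟨y, hy, rfl⟩
      exact ⟨Real.exp_pos y, Real.exp_lt_one_iff.2 hy⟩
  have e3 : ∫ s in Set.Ioi (0 : ℝ), s ^ (2 - 1) • (Set.Ioo (0 : ℝ) 1).indicator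
      (fun s => h (Real.log s) / s ^ 2) s = ∫ s in Set.Ioo (0 : ℝ) 1, h (Real.log s) / s := by
    rw [← integral_indicator measurableSet_Ioi, ← integral_indicator measurableSet_Ioo]
    congr 1 with s
    by_cases hs : s ∈ Set.Ioo (0 : ℝ) 1
    · rw [Set.indicator_of_mem hs, Set.indicator_of_mem (show s ∈ Set.Ioi (0 : ℝ) from hs.1),
        Set.indicator_of_mem hs]
      have := hs.1.ne'
      simp only [smul_eq_mul, Nat.add_one_sub_one, pow_one]
      field_simp
    · rw [Set.indicator_of_notMem hs]
      by_cases hs0 : s ∈ Set.Ioi (0 : ℝ)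
      · rw [Set.indicator_of_mem hs0, Set.indicator_of_notMem hs, smul_zero]
      · rw [Set.indicator_of_notMem hs0]
  -- Polar coordinates give $2\pi\int h(\log s)\,ds/s$, and $s=e^y$ turns $ds/s$ into $dy$.
  rw [e1, integral_fun_norm_addHaar, Complex.finrank_real_complex, e3, e2,
    integral_image_eq_integral_abs_deriv_smul measurableSet_Iio
      (fun y _ => (Real.hasDerivAt_exp y).hasDerivWithinAt) Real.exp_injective.injOn]
  have e4 : (volume : Measure ℂ).real (Metric.ball 0 1) = Real.pi := by
    simp [Measure.real, Complex.volume_ball]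
  rw [e4, nsmul_eq_mul, smul_eq_mul, ← mul_assoc]
  congr 1
  refine setIntegral_congr_fun measurableSet_Iio fun y _ => ?_
  simp only [abs_of_pos (Real.exp_pos y), Real.log_exp, smul_eq_mul]
  field_simp

theorem setIntegral_comp_neg_sqrt {x : ℝ} (hx : x < 0) (h : ℝ → ℝ) :
    ∫ y in Set.Iio 0, h (-√(x * y)) = ∫ t in Set.Iio 0, 2 * t / x * h t := by
  -- The substitution $y=t^2/x$ with $t<0$, so $dy=(2t/x)\,dt$.
  have e : (Set.Iio 0 : Set ℝ) = (fun t => t ^ 2 / x) '' Set.Iio 0 := by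
    ext y
    constructor
    · intro hy
      have hxy : 0 < x * y := mul_pos_of_neg_of_neg hx hy
      refine ⟨-√(x * y), neg_lt_zero.2 (Real.sqrt_pos.2 hxy), ?_⟩
      simp only [neg_sq, Real.sq_sqrt hxy.le]
      field_simp [hx.ne]
    · rintro ⟨t, ht, rfl⟩
      exact div_neg_of_pos_of_neg (sq_pos_of_neg ht) hx
  have hinj : Set.InjOn (fun t : ℝ => t ^ 2 / x) (Set.Iio 0) := by
    intro s hs t ht hst
    simp only [div_left_inj' hx.ne] at hst
    rcases sq_eq_sq_iff_eq_or_eq_neg.1 hst with h | h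
    · exact h
    · simp only [Set.mem_Iio] at hs ht
      linarith
  conv_lhs => rw [e]
  rw [integral_image_eq_integral_abs_deriv_smul measurableSet_Iio
      (f' := fun t => 2 * t / x)
      (fun t _ => by
        simpa using (((hasDerivAt_id t).pow 2).div_const x).hasDerivWithinAt) hinj]
  refine setIntegral_congr_fun measurableSet_Iio fun t ht => ?_
  simp only [Set.mem_Iio] at ht
  have h1 : 0 < 2 * t / x := div_pos_of_neg_of_neg (by linarith) hx
  have h2 : -√(x * (t ^ 2 / x)) = t := by
    rw [mul_div_cancel₀ _ hx.ne, Real.sqrt_sq_eq_abs, abs_of_neg ht, neg_neg]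
  simp only [abs_of_pos h1, h2, smul_eq_mul]

/-- A toric integral over the bidisc in the coordinates `x = log |z|`,
`t = -√(log |z| log |w|)`. -/
theorem setIntegral_toricBidisc {N : ℝ → ℝ → ℝ}
    (hN : IntegrableOn (fun p => N (Real.log ‖p.1‖) (blockiReal p) / (‖p.1‖ ^ 2 * ‖p.2‖ ^ 2))
      toricBidisc) :
    ∫ p in toricBidisc, N (Real.log ‖p.1‖) (blockiReal p) / (‖p.1‖ ^ 2 * ‖p.2‖ ^ 2)
      = 4 * Real.pi ^ 2 * ∫ x in Set.Iio 0, ∫ t in Set.Iio 0, 2 * t / x * N x t := by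
  rw [toricBidisc_eq_prod] at hN ⊢
  rw [Measure.volume_eq_prod] at hN ⊢
  rw [setIntegral_prod _ hN]
  have e : ∀ z ∈ puncturedDisc, ∫ w in puncturedDisc, N (Real.log ‖z‖) (blockiReal (z, w))
      / (‖z‖ ^ 2 * ‖w‖ ^ 2) = (fun x => 2 * Real.pi * ∫ t in Set.Iio 0, 2 * t / x * N x t)
        (Real.log ‖z‖) / ‖z‖ ^ 2 := by
    intro z hz
    have hx := Real.log_neg (norm_pos_iff.2 hz.1) hz.2
    have h1 := setIntegral_puncturedDisc fun y => N (Real.log ‖z‖) (-√(Real.log ‖z‖ * y))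
    rw [setIntegral_comp_neg_sqrt hx] at h1
    simp only
    rw [← h1, ← integral_div]
    refine setIntegral_congr_fun measurableSet_puncturedDisc fun w _ => ?_
    simp only [blockiReal]
    rw [div_div, mul_comm (‖w‖ ^ 2)]
  rw [setIntegral_congr_fun measurableSet_puncturedDisc e,
    setIntegral_puncturedDisc (fun x => 2 * Real.pi * ∫ t in Set.Iio 0, 2 * t / x * N x t),
    integral_const_mul]
  ring

end Radial

/-! ### Reduction to one variable and the energy bound -/

section OneVariable

theorem integrable_of_continuousOn_Icc {k : ℝ → ℝ} {a b : ℝ} (h : ContinuousOn k (Set.Icc a b))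
    (h0 : ∀ t, t ∉ Set.Icc a b → k t = 0) : Integrable k :=
  (integrableOn_iff_integrable_of_support_subset fun _ ht => by_contra fun h => ht (h0 _ h)).1
    h.integrableOn_Icc

theorem deriv_eq_zero_of_eqOn_const {f : ℝ → ℝ} {U : Set ℝ} (hU : IsOpen U) {c : ℝ}
    (h : ∀ t ∈ U, f t = c) : ∀ t ∈ U, deriv f t = 0 := fun t ht => by
  have e : f =ᶠ[𝓝 t] fun _ => c := by
    filter_upwards [hU.mem_nhds ht] with s hs using h s hs
  rw [e.deriv_eq, deriv_const]

theorem ContDiff.deriv_infty {f : ℝ → ℝ} (hf : ContDiff ℝ ∞ f) : ContDiff ℝ ∞ (deriv f) :=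
  (contDiff_infty_iff_deriv.1 hf).2

theorem ContDiff.hasDerivAt_infty {f : ℝ → ℝ} (hf : ContDiff ℝ ∞ f) (t : ℝ) :
    HasDerivAt f (deriv f t) t :=
  ((contDiff_infty_iff_deriv.1 hf).1 t).hasDerivAt

variable {α B g : ℝ → ℝ}

theorem integral_deriv_eq_zero_of_Icc (hα : ContDiff ℝ ∞ α) {a b : ℝ}
    (h0 : ∀ t, t ∉ Set.Icc a b → α t = 0) : ∫ x, deriv α x = 0 :=
  integral_eq_zero_of_hasDerivAt_of_integrable hα.hasDerivAt_infty
    (integrable_of_continuousOn_Icc hα.deriv_infty.continuous.continuousOn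
      (deriv_eq_zero_of_eqOn_const isClosed_Icc.isOpen_compl h0))
    (integrable_of_continuousOn_Icc hα.continuous.continuousOn h0)

theorem integral_mul_deriv_deriv_eq_zero (hα : ContDiff ℝ ∞ α) {a b : ℝ}
    (h0 : ∀ t, t ∉ Set.Icc a b → α t = 0) : ∫ x, x * deriv (deriv α) x = 0 := by
  have hα' := hα.deriv_infty
  have z1 := deriv_eq_zero_of_eqOn_const isClosed_Icc.isOpen_compl h0
  have z2 := deriv_eq_zero_of_eqOn_const isClosed_Icc.isOpen_compl z1
  refine integral_eq_zero_of_hasDerivAt_of_integrable (f := fun x => x * deriv α x - α x)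
    (fun x => ?_) ?_ ?_
  · have : HasDerivAt (fun x => x * deriv α x - α x)
        (1 * deriv α x + x * deriv (deriv α) x - deriv α x) x :=
      ((hasDerivAt_id x).mul (hα'.hasDerivAt_infty x)).sub (hα.hasDerivAt_infty x)
    exact this.congr_deriv (by ring)
  · refine integrable_of_continuousOn_Icc (a := a) (b := b)
      (continuous_id.mul hα'.deriv_infty.continuous).continuousOn fun t ht => ?_
    rw [z2 t ht, mul_zero]
  · refine integrable_of_continuousOn_Icc (a := a) (b := b)
      ((continuous_id.mul hα'.continuous).sub hα.continuous).continuousOn fun t ht => ?_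
    rw [z1 t ht, h0 t ht, mul_zero, sub_zero]

theorem setIntegral_Iio_eq_integral {k : ℝ → ℝ} (h : ∀ t, 0 ≤ t → k t = 0) :
    ∫ t in Set.Iio 0, k t = ∫ t, k t :=
  setIntegral_eq_integral_of_forall_compl_eq_zero fun t ht => h t (not_lt.1 ht)

/-- The integral of the Monge-Ampère density reduces to a one-variable integral. -/
theorem integral_toricDensity (hα : ContDiff ℝ ∞ α) (hα0 : ∀ x, α x ≠ 0 → -3 < x ∧ x < -1)
    (hB : ContDiff ℝ ∞ B) (hB0 : ∀ t, -1 ≤ t → B t = 0)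
    (hg : ContDiff ℝ ∞ g) {c T : ℝ} (hc : ∀ t ≤ T, g t = c) :
    ∫ x in Set.Iio 0, ∫ t in Set.Iio 0, 2 * t / x * toricDensity g α B x t
      = (∫ x in Set.Iio 0, -(α x) / x) / 2
        * ∫ t, g t * (deriv (deriv g) t * deriv B t + deriv g t * deriv (deriv B) t) := by
  have hα1 : ∀ t, t ∉ Set.Icc (-3 : ℝ) (-1) → α t = 0 := fun t ht => by
    by_contra h
    exact ht ⟨(hα0 t h).1.le, (hα0 t h).2.le⟩
  have zα' := deriv_eq_zero_of_eqOn_const isClosed_Icc.isOpen_compl hα1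
  have zα'' := deriv_eq_zero_of_eqOn_const isClosed_Icc.isOpen_compl zα'
  have zg' : ∀ t ∈ Set.Iio T, deriv g t = 0 :=
    deriv_eq_zero_of_eqOn_const isOpen_Iio fun t ht => hc t (le_of_lt ht)
  have zg'' := deriv_eq_zero_of_eqOn_const isOpen_Iio zg'
  have zB : ∀ t ∈ Set.Ioi (-1 : ℝ), B t = 0 := fun t ht => hB0 t (le_of_lt ht)
  have zB' := deriv_eq_zero_of_eqOn_const isOpen_Ioi zB
  have zB'' := deriv_eq_zero_of_eqOn_const isOpen_Ioi zB'
  have cg := hg.continuous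
  have cg' := hg.deriv_infty.continuous
  have cg'' := hg.deriv_infty.deriv_infty.continuous
  have cB := hB.continuous
  have cB' := hB.deriv_infty.continuous
  have cB'' := hB.deriv_infty.deriv_infty.continuous
  have hsplit : ∀ t, t ∉ Set.Icc T (-1) → t ∈ Set.Iio T ∨ t ∈ Set.Ioi (-1 : ℝ) := fun t ht => by
    by_contra h
    simp only [not_or, Set.mem_Iio, Set.mem_Ioi, not_lt] at h
    exact ht h
  have hne : ∀ t ∈ Set.Icc T (-1 : ℝ), t ≠ 0 := fun t ht h => by
    have := ht.2; rw [h] at this; norm_num at this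
  -- Times the Jacobian $2t/x$, the density is a sum of three products of a function of $x$ and a
  -- function of $t$. The $x$-factors of `k₂` and `k₃` are $x\alpha''$ and $\alpha'$, whose
  -- integrals vanish; only `k₁` survives. All three vanish off `[T, -1]`, since $g'=0$ below `T`
  -- and $B=0$ above `-1`.
  set k₁ : ℝ → ℝ := fun t =>
    g t * (deriv (deriv g) t * deriv B t + deriv g t * deriv (deriv B) t) with hk₁
  set k₂ : ℝ → ℝ := fun t =>
    g t * B t * (deriv (deriv g) t / (2 * t) - deriv g t / (2 * t ^ 2)) with hk₂
  set k₃ : ℝ → ℝ := fun t => g t * deriv B t * deriv g t / t with hk₃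
  have i₁ : Integrable k₁ := by
    refine integrable_of_continuousOn_Icc (a := T) (b := -1)
      (cg.mul ((cg''.mul cB').add (cg'.mul cB''))).continuousOn fun t ht => ?_
    rcases hsplit t ht with h | h
    · simp [hk₁, zg' t h, zg'' t h]
    · simp [hk₁, zB' t h, zB'' t h]
  have i₂ : Integrable k₂ := by
    refine integrable_of_continuousOn_Icc (a := T) (b := -1) ?_ fun t ht => ?_
    · refine (cg.mul cB).continuousOn.mul ((cg''.continuousOn.div
        (continuous_const.mul continuous_id).continuousOn fun t ht => ?_).sub
        (cg'.continuousOn.div (continuous_const.mul (continuous_id.pow 2)).continuousOn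
          fun t ht => ?_))
      · simpa using hne t ht
      · simpa using hne t ht
    · rcases hsplit t ht with h | h
      · simp [hk₂, zg' t h, zg'' t h]
      · simp [hk₂, zB t h]
  have i₃ : Integrable k₃ := by
    refine integrable_of_continuousOn_Icc (a := T) (b := -1)
      (((cg.mul cB').mul cg').continuousOn.div continuous_id.continuousOn hne) fun t ht => ?_
    rcases hsplit t ht with h | h
    · simp [hk₃, zg' t h]
    · simp [hk₃, zB' t h]
  have inner : ∀ x ∈ Set.Iio (0 : ℝ), ∫ t in Set.Iio 0, 2 * t / x * toricDensity g α B x t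
      = -(α x) / x * ((∫ t in Set.Iio 0, k₁ t) / 2)
        + x * deriv (deriv α) x * (∫ t in Set.Iio 0, k₂ t)
        - deriv α x * ∫ t in Set.Iio 0, k₃ t := by
    intro x hx
    have hx0 : x ≠ 0 := ne_of_lt hx
    have j₁ : IntegrableOn (fun t => -(α x) / x * (k₁ t / 2)) (Set.Iio 0) :=
      ((i₁.div_const 2).const_mul _).integrableOn
    have j₂ : IntegrableOn (fun t => x * deriv (deriv α) x * k₂ t) (Set.Iio 0) :=
      (i₂.const_mul _).integrableOn
    have j₃ : IntegrableOn (fun t => deriv α x * k₃ t) (Set.Iio 0) :=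
      (i₃.const_mul _).integrableOn
    have j₁₂ : IntegrableOn (fun t => -(α x) / x * (k₁ t / 2) + x * deriv (deriv α) x * k₂ t)
      (Set.Iio 0) := j₁.add j₂
    rw [← integral_div, ← integral_const_mul, ← integral_const_mul, ← integral_const_mul,
      ← integral_add j₁ j₂, ← integral_sub j₁₂ j₃]
    refine setIntegral_congr_fun measurableSet_Iio fun t ht => ?_
    have ht0 : t ≠ 0 := ne_of_lt ht
    simp only [toricDensity, hk₁, hk₂, hk₃]
    field_simp
    ring
  rw [setIntegral_congr_fun measurableSet_Iio inner]
  have l₁ : IntegrableOn (fun x => -(α x) / x * ((∫ t in Set.Iio 0, k₁ t) / 2)) (Set.Iio 0) := by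
    refine (Integrable.mul_const ?_ _).integrableOn
    refine integrable_of_continuousOn_Icc (a := -3) (b := -1)
      (hα.continuous.neg.continuousOn.div continuous_id.continuousOn fun x hx h => ?_)
      fun x hx => ?_
    · rw [show x = 0 from h] at hx
      norm_num at hx
    · simp [hα1 x hx]
  have l₂ : IntegrableOn (fun x => x * deriv (deriv α) x * ∫ t in Set.Iio 0, k₂ t)
      (Set.Iio 0) := by
    refine (Integrable.mul_const ?_ _).integrableOn
    refine integrable_of_continuousOn_Icc (a := -3) (b := -1)
      (continuous_id.mul hα.deriv_infty.deriv_infty.continuous).continuousOn fun x hx => ?_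
    simp [zα'' x hx]
  have l₃ : IntegrableOn (fun x => deriv α x * ∫ t in Set.Iio 0, k₃ t) (Set.Iio 0) := by
    refine (Integrable.mul_const ?_ _).integrableOn
    exact integrable_of_continuousOn_Icc (a := -3) (b := -1)
      hα.deriv_infty.continuous.continuousOn zα'
  have l₁₂ : IntegrableOn (fun x => -(α x) / x * ((∫ t in Set.Iio 0, k₁ t) / 2)
      + x * deriv (deriv α) x * ∫ t in Set.Iio 0, k₂ t) (Set.Iio 0) := l₁.add l₂
  have hIcc : ∀ x : ℝ, 0 ≤ x → x ∉ Set.Icc (-3 : ℝ) (-1) := fun x hx h => by linarith [h.2]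
  rw [integral_sub l₁₂ l₃, integral_add l₁ l₂, integral_mul_const, integral_mul_const,
    integral_mul_const,
    setIntegral_Iio_eq_integral (k := fun x => x * deriv (deriv α) x)
      (fun x hx => by rw [zα'' x (hIcc x hx), mul_zero]),
    setIntegral_Iio_eq_integral (k := deriv α) (fun x hx => zα' x (hIcc x hx)),
    integral_mul_deriv_deriv_eq_zero hα hα1, integral_deriv_eq_zero_of_Icc hα hα1,
    setIntegral_Iio_eq_integral (k := k₁) (fun t ht => by
      have h : t ∈ Set.Ioi (-1 : ℝ) := lt_of_lt_of_le (by norm_num) ht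
      simp [hk₁, zB' t h, zB'' t h])]
  ring

theorem integral_mul_deriv_eq_neg {f k : ℝ → ℝ} (hf : ContDiff ℝ ∞ f) (hk : ContDiff ℝ ∞ k)
    {a b : ℝ} (h0 : ∀ t, t ∉ Set.Icc a b → k t = 0) :
    ∫ t, f t * deriv k t = -∫ t, deriv f t * k t := by
  have z := deriv_eq_zero_of_eqOn_const isClosed_Icc.isOpen_compl h0
  refine integral_mul_deriv_eq_deriv_mul_of_integrable (fun t _ => hf.hasDerivAt_infty t)
    (fun t _ => hk.hasDerivAt_infty t) ?_ ?_ ?_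
  · refine integrable_of_continuousOn_Icc (a := a) (b := b)
      (hf.continuous.mul hk.deriv_infty.continuous).continuousOn fun t ht => ?_
    simp [z t ht]
  · refine integrable_of_continuousOn_Icc (a := a) (b := b)
      (hf.deriv_infty.continuous.mul hk.continuous).continuousOn fun t ht => ?_
    simp [h0 t ht]
  · refine integrable_of_continuousOn_Icc (a := a) (b := b)
      (hf.continuous.mul hk.continuous).continuousOn fun t ht => ?_
    simp [h0 t ht]

theorem deriv_eq_zero_of_notMem_Icc (hB0 : ∀ t, -1 ≤ t → B t = 0) (hB1 : ∀ t ≤ -2, B t = 1)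
    (t : ℝ) (ht : t ∉ Set.Icc (-2 : ℝ) (-1)) : deriv B t = 0 := by
  by_cases h : t < -2
  · exact deriv_eq_zero_of_eqOn_const isOpen_Iio (c := 1) (fun t ht => hB1 t (le_of_lt ht)) t h
  · refine deriv_eq_zero_of_eqOn_const isOpen_Ioi (U := Set.Ioi (-1)) (c := 0)
      (fun t ht => hB0 t (le_of_lt ht)) t ?_
    by_contra hlt
    exact ht ⟨not_lt.1 h, not_lt.1 hlt⟩

/-- The energy `∫ g'² (-B')` dominates an expression that is linear in `g`. -/
theorem le_integral_energy (hB : ContDiff ℝ ∞ B) (hB0 : ∀ t, -1 ≤ t → B t = 0)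
    (hB1 : ∀ t ≤ -2, B t = 1) (hBa : Antitone B) (hg : ContDiff ℝ ∞ g) :
    2 * (∫ t, g t * deriv (deriv B) t) + ∫ t, deriv B t
      ≤ ∫ t, g t * (deriv (deriv g) t * deriv B t + deriv g t * deriv (deriv B) t) := by
  have z1 := deriv_eq_zero_of_notMem_Icc hB0 hB1
  have z2 := deriv_eq_zero_of_eqOn_const isClosed_Icc.isOpen_compl z1
  have hB' := hB.deriv_infty
  have hg' := hg.deriv_infty
  have I : ∀ {k : ℝ → ℝ}, Continuous k → Integrable fun t => k t * deriv B t := fun hk =>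
    integrable_of_continuousOn_Icc (a := -2) (b := -1)
      (hk.mul hB'.continuous).continuousOn fun t ht => by simp [z1 t ht]
  have I' : ∀ {k : ℝ → ℝ}, Continuous k → Integrable fun t => k t * deriv (deriv B) t := fun hk =>
    integrable_of_continuousOn_Icc (a := -2) (b := -1)
      (hk.mul hB'.deriv_infty.continuous).continuousOn fun t ht => by simp [z2 t ht]
  have e1 : ∫ t, g t * deriv (deriv B) t = -∫ t, deriv g t * deriv B t :=
    integral_mul_deriv_eq_neg hg hB' z1
  -- Integrating $gg'B''$ by parts cancels the $gg''B'$ term and leaves the energy $-\int g'^2B'$.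
  have e2 : ∫ t, (g t * deriv g t) * deriv (deriv B) t
      = -∫ t, (deriv g t * deriv g t + g t * deriv (deriv g) t) * deriv B t := by
    rw [integral_mul_deriv_eq_neg (hg.mul hg') hB' z1]
    congr 2 with t
    rw [deriv_fun_mul (hg.hasDerivAt_infty t).differentiableAt
      (hg'.hasDerivAt_infty t).differentiableAt]
  have e3 : ∫ t, g t * (deriv (deriv g) t * deriv B t + deriv g t * deriv (deriv B) t)
      = -∫ t, (deriv g t * deriv g t) * deriv B t := by
    have h1 : ∀ t, g t * (deriv (deriv g) t * deriv B t + deriv g t * deriv (deriv B) t)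
        = (g t * deriv (deriv g) t) * deriv B t + (g t * deriv g t) * deriv (deriv B) t :=
      fun t => by ring
    have h2 : ∀ t, (deriv g t * deriv g t + g t * deriv (deriv g) t) * deriv B t
        = (deriv g t * deriv g t) * deriv B t + (g t * deriv (deriv g) t) * deriv B t :=
      fun t => by ring
    have c1 : Continuous fun t => g t * deriv (deriv g) t :=
      hg.continuous.mul hg'.deriv_infty.continuous
    have c2 : Continuous fun t => deriv g t * deriv g t := hg'.continuous.mul hg'.continuous
    have c3 : Continuous fun t => g t * deriv g t := hg.continuous.mul hg'.continuous
    simp only [h2] at e2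
    rw [integral_add (I c2) (I c1)] at e2
    simp only [h1]
    rw [integral_add (I c1) (I' c3), e2]
    ring
  rw [e3, e1, ← integral_neg, ← integral_const_mul]
  have i1 : Integrable fun t => 2 * -(deriv g t * deriv B t) := ((I hg'.continuous).neg).const_mul 2
  have i2 : Integrable fun t => deriv B t := by simpa using I (k := fun _ => 1) continuous_const
  rw [← integral_neg, ← integral_add i1 i2]
  -- The difference of the integrands is $(g'-1)^2(-B')\ge0$. Equality at $g'=1$ makes the bound
  -- sharp in the limit $\chi_m(t)\to t$.
  refine integral_mono (i1.add i2) (I (hg'.continuous.mul hg'.continuous)).neg fun t => ?_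
  have hneg : deriv B t ≤ 0 := hBa.deriv_nonpos
  simp only
  nlinarith [mul_nonneg (sq_nonneg (deriv g t - 1)) (neg_nonneg.2 hneg)]

end OneVariable

/-! ### Smooth convex approximation of $\chi$ -/

section Smoothing

/-- The slope on $[a,b]$ is at most the slope on $[b,c]$ for $b<c<0$. As $\chi(c)<0$ and $\chi(b)\ge
b$, the latter is at most $-b/(c-b)$, which tends to $1$ as $c\to0$. -/
theorem lipschitz_of_convexOn {χ : ℝ → ℝ} (hneg : Set.MapsTo χ (Set.Iio 0) (Set.Iio 0))
    (hconv : ConvexOn ℝ (Set.Iio 0) χ) (hle : ∀ t < 0, t ≤ χ t) {a b : ℝ} (hab : a < b)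
    (hb : b < 0) : χ b - χ a ≤ b - a := by
  have h : ∀ c ∈ Set.Ioo b 0, (χ b - χ a) * (c - b) ≤ -b * (b - a) := by
    intro c hc
    have hs := hconv.slope_mono_adjacent (hab.trans hb) hc.2 hab hc.1
    rw [div_le_div_iff₀ (by linarith) (by linarith [hc.1])] at hs
    refine hs.trans (mul_le_mul_of_nonneg_right ?_ (by linarith))
    have h1 : χ c < 0 := hneg hc.2
    linarith [hle b hb]
  have hlim : Tendsto (fun c => (χ b - χ a) * (c - b)) (𝓝[<] 0) (𝓝 ((χ b - χ a) * (0 - b))) :=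
    ((continuous_const.mul (continuous_id.sub continuous_const)).tendsto 0).mono_left
      nhdsWithin_le_nhds
  have h' := le_of_tendsto hlim (by
    filter_upwards [Ioo_mem_nhdsLT hb] with c hc using h c hc)
  have hb' : 0 < -b := by linarith
  nlinarith

/-- A smooth approximation of a bounded convex non-decreasing function, constant near `-∞`. -/
theorem exists_smooth_convex_approx {χ : ℝ → ℝ} (hneg : Set.MapsTo χ (Set.Iio 0) (Set.Iio 0))
    (hbdd : Bornology.IsBounded (χ '' Set.Iio 0)) (hconv : ConvexOn ℝ (Set.Iio 0) χ)
    (hmono : MonotoneOn χ (Set.Iio 0)) (hle : ∀ t < 0, t ≤ χ t) {ε : ℝ} (hε : 0 < ε) :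
    ∃ (g : ℝ → ℝ) (c T : ℝ), ContDiff ℝ ∞ g ∧ (∀ t ≤ T, g t = c) ∧ (∀ t < 0, 0 ≤ deriv g t) ∧
      (∀ t < 0, 0 ≤ deriv (deriv g) t) ∧ (∀ t < 0, |g t - χ t| ≤ ε) ∧
      |c - sInf (χ '' Set.Iio 0)| ≤ ε := by
  set c₀ := sInf (χ '' Set.Iio 0) with hc₀
  set δ := ε / 3 with hδ
  have hδ0 : 0 < δ := by positivity
  have hne : (χ '' Set.Iio 0).Nonempty := ⟨χ (-1), -1, by norm_num, rfl⟩
  have hc₀le : ∀ t < 0, c₀ ≤ χ t := fun t ht => csInf_le hbdd.bddBelow ⟨t, ht, rfl⟩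
  obtain ⟨_, ⟨t₀, ht₀, rfl⟩, htc⟩ := exists_lt_of_csInf_lt hne (show c₀ < c₀ + δ by linarith)
  -- The shift by `δ` makes `F` convex up to `δ`, so averaging over radius `δ` is harmless for every
  -- `t < 0`. The maximum with `c₀ + δ` makes `F` constant far to the left. The value from `δ` on
  -- only serves to keep `F` monotone, hence locally integrable.
  set F : ℝ → ℝ := fun t => if t < δ then max (χ (t - δ)) (c₀ + δ) else max 0 (c₀ + δ) with hF
  have hFlt : ∀ {t}, t < δ → F t = max (χ (t - δ)) (c₀ + δ) := fun h => if_pos h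
  have hFmono : Monotone F := by
    intro s t hst
    by_cases ht : t < δ
    · rw [hFlt ht, hFlt (hst.trans_lt ht)]
      exact max_le_max_right _ (hmono (sub_neg.2 (hst.trans_lt ht)) (sub_neg.2 ht)
        (sub_le_sub_right hst δ))
    · simp only [hF, if_neg ht]
      split_ifs with hs
      · exact max_le_max_right _ (le_of_lt (hneg (sub_neg.2 hs)))
      · exact le_rfl
  have hFconv : ∀ s t a b : ℝ, s < δ → t < δ → 0 ≤ a → 0 ≤ b → a + b = 1 →
      F (a * s + b * t) ≤ a * F s + b * F t := by
    intro s t a b hs ht ha hb hab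
    have hst : a * s + b * t < δ := by
      have := (convex_Iio δ) hs ht ha hb hab
      simpa using this
    rw [hFlt hst]
    have h1 := mul_le_mul_of_nonneg_left (le_max_left (χ (s - δ)) (c₀ + δ)) ha
    have h2 := mul_le_mul_of_nonneg_left (le_max_left (χ (t - δ)) (c₀ + δ)) hb
    have h3 := mul_le_mul_of_nonneg_left (le_max_right (χ (s - δ)) (c₀ + δ)) ha
    have h4 := mul_le_mul_of_nonneg_left (le_max_right (χ (t - δ)) (c₀ + δ)) hb
    rw [← hFlt hs] at h1 h3
    rw [← hFlt ht] at h2 h4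
    refine max_le ?_ ?_
    · have hc := hconv.2 (show s - δ ∈ Set.Iio 0 from sub_neg.2 hs)
        (show t - δ ∈ Set.Iio 0 from sub_neg.2 ht) ha hb hab
      have e : a • (s - δ) + b • (t - δ) = a * s + b * t - δ := by
        simp only [smul_eq_mul]
        linear_combination (-δ) * hab
      rw [e, smul_eq_mul, smul_eq_mul] at hc
      linarith
    · have e : c₀ + δ = a * (c₀ + δ) + b * (c₀ + δ) := by rw [← add_mul, hab, one_mul]
      linarith
  have hFlip : ∀ s t : ℝ, s < t → t < δ → F t - F s ≤ t - s := by
    intro s t hst ht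
    rw [hFlt ht, hFlt (hst.trans ht)]
    have h := lipschitz_of_convexOn hneg hconv hle (sub_lt_sub_right hst δ) (sub_neg.2 ht)
    have h1 := le_max_left (χ (s - δ)) (c₀ + δ)
    have h2 := le_max_right (χ (s - δ)) (c₀ + δ)
    rcases max_cases (χ (t - δ)) (c₀ + δ) with ⟨h3, -⟩ | ⟨h3, -⟩ <;> rw [h3] <;> linarith
  let φ : ContDiffBump (0 : ℝ) := ⟨δ / 2, δ, by positivity, by linarith⟩
  have hφ : φ.rOut = δ := rfl
  have hφ0 : ∀ s : ℝ, δ ≤ |s| → φ.normed volume s = 0 := fun s hs => by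
    rw [← Function.notMem_support, φ.support_normed_eq, hφ]
    simpa using hs
  set g : ℝ → ℝ := φ.normed volume ⋆[ContinuousLinearMap.lsmul ℝ ℝ, volume] F with hg
  have hgdef : ∀ t, g t = ∫ s, φ.normed volume s * F (t - s) := fun t => rfl
  have hgint : ∀ t, Integrable fun s => φ.normed volume s * F (t - s) := fun t =>
    (φ.hasCompactSupport_normed.convolutionExists_left (ContinuousLinearMap.lsmul ℝ ℝ)
      φ.continuous_normed hFmono.locallyIntegrable t)
  have hgsmooth : ContDiff ℝ ∞ g :=
    φ.hasCompactSupport_normed.contDiff_convolution_left (ContinuousLinearMap.lsmul ℝ ℝ)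
      (φ.contDiff_normed (n := ⊤)) hFmono.locallyIntegrable
  have hgmono : Monotone g := by
    intro s t hst
    rw [hgdef, hgdef]
    exact integral_mono (hgint s) (hgint t) fun r =>
      mul_le_mul_of_nonneg_left (hFmono (sub_le_sub_right hst r)) (φ.nonneg_normed r)
  have hgconv : ConvexOn ℝ (Set.Iio 0) g := by
    refine ⟨convex_Iio 0, fun s hs t ht a b ha hb hab => ?_⟩
    simp only [smul_eq_mul, hgdef]
    rw [← integral_const_mul, ← integral_const_mul,
      ← integral_add ((hgint s).const_mul a) ((hgint t).const_mul b)]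
    refine integral_mono (hgint _) (((hgint s).const_mul a).add ((hgint t).const_mul b)) fun r => ?_
    by_cases hr : δ ≤ |r|
    · simp [hφ0 r hr]
    · have hr' := (abs_lt.1 (not_le.1 hr)).1
      simp only [Set.mem_Iio] at hs ht
      have h := hFconv (s - r) (t - r) a b (by linarith) (by linarith) ha hb hab
      have e : a * (s - r) + b * (t - r) = a * s + b * t - r := by
        linear_combination (-r) * hab
      rw [e] at h
      have h' := mul_le_mul_of_nonneg_left h (φ.nonneg_normed (μ := volume) r)
      simp only
      linarith
  refine ⟨g, c₀ + δ, t₀, hgsmooth, fun t ht => ?_, fun t _ => hgmono.deriv_nonneg, fun t ht => ?_,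
    fun t ht => ?_, ?_⟩
  -- For `t ≤ t₀` the whole averaging ball lies in the region where `F` is constant, so `T = t₀`
  -- works.
  · have hFc : ∀ x < t₀ + δ, F x = c₀ + δ := fun x hx => by
      have hx0 : x - δ ≤ t₀ := by linarith
      rw [hFlt (by linarith [show t₀ < 0 from ht₀]), max_eq_right]
      exact (hmono (lt_of_le_of_lt hx0 ht₀) ht₀ hx0).trans htc.le
    have htF : F t = c₀ + δ := hFc t (by linarith)
    rw [hg, ContDiffBump.normed_convolution_eq_right, htF]
    intro x hx
    rw [htF]
    refine hFc x ?_
    rw [hφ, Metric.mem_ball, Real.dist_eq] at hx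
    linarith [(abs_lt.1 hx).2]
  · have hm := hgconv.monotoneOn_deriv fun x _ => (hgsmooth.hasDerivAt_infty x).differentiableAt
    rw [← derivWithin_of_mem_nhds (isOpen_Iio.mem_nhds ht)]
    exact hm.derivWithin_nonneg
  -- Since `F` is 1-Lipschitz below `δ`, the averaging costs at most `δ`; shift and truncation are
  -- bounded by `2 * δ`, which explains `δ = ε / 3`.
  · have h1 : dist (g t) (F t) ≤ δ := by
      refine ContDiffBump.dist_normed_convolution_le
        hFmono.measurable.aestronglyMeasurable fun x hx => ?_
      rw [hφ, Metric.mem_ball, Real.dist_eq] at hx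
      have hx' := abs_lt.1 hx
      rw [Real.dist_eq]
      rcases lt_trichotomy x t with h | h | h
      · have := hFlip x t h (by linarith)
        have := hFmono h.le
        rw [abs_le]; constructor <;> linarith
      · rw [h, sub_self, abs_zero]; exact hδ0.le
      · have := hFlip t x h (by linarith)
        have := hFmono h.le
        rw [abs_le]; constructor <;> linarith
    rw [Real.dist_eq, abs_le] at h1
    have h2 : |F t - χ t| ≤ 2 * δ := by
      rw [hFlt (by linarith)]
      have l := lipschitz_of_convexOn hneg hconv hle (show t - δ < t by linarith) ht
      have m := hmono (show t - δ ∈ Set.Iio 0 from by simp only [Set.mem_Iio]; linarith) ht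
        (show t - δ ≤ t by linarith)
      have := hc₀le t ht
      rw [abs_le]
      constructor
      · linarith [le_max_left (χ (t - δ)) (c₀ + δ)]
      · rw [sub_le_iff_le_add]
        exact max_le (by linarith) (by linarith)
    rw [abs_le] at h2 ⊢
    constructor <;> linarith [h1.1, h1.2, h2.1, h2.2]
  · rw [add_sub_cancel_left, abs_of_pos hδ0]
    linarith

end Smoothing

theorem hasLeviMeasures_toricExt {g : ℝ → ℝ} (hg : ContDiff ℝ 2 g) {c T : ℝ}
    (hc : ∀ t ≤ T, g t = c) (h1 : ∀ t < 0, 0 ≤ deriv g t) (h2 : ∀ t < 0, 0 ≤ deriv (deriv g) t) :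
    HasLeviMeasures puncturedBidisc (toricExt g c) :=
  hasLeviMeasures_of_tendstoUniformlyOn (w := fun _ => toricExt g c)
    (fun _ => contDiffOn_toricExt hg hc) (fun _ => leviForm_toricExt_nonneg hg c h1 h2)
    (Metric.tendstoUniformlyOn_iff.2 fun ε hε => Eventually.of_forall fun _ p _ => by
      simpa using hε)

/-- The bound `3` fits both uses: on `[-2, -1]` one has $-2\le\chi<0$, and the smooth approximants
differ from $\chi$ by at most `1`. -/
theorem tendsto_integral_mul_of_bounded {k : ℝ → ℝ} (hk : Continuous k)
    (hk0 : ∀ t, t ∉ Set.Icc (-2 : ℝ) (-1) → k t = 0) {f : ℕ → ℝ → ℝ} {f₀ : ℝ → ℝ}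
    (hf : ∀ n, ContinuousOn (f n) (Set.Icc (-2) (-1)))
    (hb : ∀ n, ∀ t ∈ Set.Icc (-2 : ℝ) (-1), |f n t| ≤ 3)
    (hlim : ∀ t ∈ Set.Icc (-2 : ℝ) (-1), Tendsto (fun n => f n t) atTop (𝓝 (f₀ t))) :
    Tendsto (fun n => ∫ t, f n t * k t) atTop (𝓝 (∫ t, f₀ t * k t)) := by
  have hzero : ∀ f : ℝ → ℝ, ∀ t, t ∉ Set.Icc (-2 : ℝ) (-1) → f t * k t = 0 := fun f t ht => by
    rw [hk0 t ht, mul_zero]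
  refine tendsto_integral_of_dominated_convergence (fun t => 3 * |k t|)
    (fun n => (integrable_of_continuousOn_Icc ((hf n).mul hk.continuousOn)
      (hzero (f n))).aestronglyMeasurable)
    ((integrable_of_continuousOn_Icc hk.continuousOn hk0).abs.const_mul 3)
    (fun n => ae_of_all _ fun t => ?_) (ae_of_all _ fun t => ?_)
  · by_cases ht : t ∈ Set.Icc (-2 : ℝ) (-1)
    · rw [Real.norm_eq_abs, abs_mul]
      exact mul_le_mul_of_nonneg_right (hb n t ht) (abs_nonneg _)
    · simp [hk0 t ht]
  · by_cases ht : t ∈ Set.Icc (-2 : ℝ) (-1)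
    · exact (hlim t ht).mul_const _
    · simp [hk0 t ht]

/-! ### The lower bound and its limit -/

section Main

variable {α B : ℝ → ℝ}

theorem le_mongeAmpere_of_smooth (hα : ContDiff ℝ ∞ α)
    (hα0 : ∀ x, α x ≠ 0 → -3 < x ∧ x < -1) (hαI : 0 ≤ ∫ x in Set.Iio 0, -(α x) / x)
    (hB : ContDiff ℝ ∞ B) (hB0 : ∀ t, -1 ≤ t → B t = 0) (hB1 : ∀ t ≤ -2, B t = 1)
    (hBa : Antitone B) {g : ℝ → ℝ} (hg : ContDiff ℝ ∞ g) {c T : ℝ} (hc : ∀ t ≤ T, g t = c)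
    (h1 : ∀ t < 0, 0 ≤ deriv g t) (h2 : ∀ t < 0, 0 ≤ deriv (deriv g) t) :
    2 * Real.pi ^ 2 * (∫ x in Set.Iio 0, -(α x) / x)
        * (2 * (∫ t, g t * deriv (deriv B) t) + ∫ t, deriv B t)
      ≤ mongeAmpere puncturedBidisc (toricExt g c) (toricTest hα hα0 hB hB0 hB1) := by
  have hg2 : ContDiff ℝ 2 g := hg.of_le (WithTop.coe_le_coe.2 le_top)
  obtain ⟨hi, he⟩ := mongeAmpere_toricExt hα hα0 hB hB0 hB1 hg2 hc h1 h2
    (hasLeviMeasures_toricExt hg2 hc h1 h2)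
  rw [he, setIntegral_toricBidisc (N := toricDensity g α B) hi,
    integral_toricDensity hα hα0 hB hB0 hg hc]
  have h := mul_le_mul_of_nonneg_left (le_integral_energy hB hB0 hB1 hBa hg)
    (show 0 ≤ 2 * Real.pi ^ 2 * ∫ x in Set.Iio 0, -(α x) / x by positivity)
  linarith

theorem hasLeviMeasures_and_le_mongeAmpere (hα : ContDiff ℝ ∞ α)
    (hα0 : ∀ x, α x ≠ 0 → -3 < x ∧ x < -1) (hαI : 0 ≤ ∫ x in Set.Iio 0, -(α x) / x)
    (hB : ContDiff ℝ ∞ B) (hB0 : ∀ t, -1 ≤ t → B t = 0) (hB1 : ∀ t ≤ -2, B t = 1)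
    (hBa : Antitone B) {χ : ℝ → ℝ} (hneg : Set.MapsTo χ (Set.Iio 0) (Set.Iio 0))
    (hbdd : Bornology.IsBounded (χ '' Set.Iio 0)) (hconv : ConvexOn ℝ (Set.Iio 0) χ)
    (hmono : MonotoneOn χ (Set.Iio 0)) (hle : ∀ t < 0, t ≤ χ t) :
    HasLeviMeasures puncturedBidisc (toricExt χ (sInf (χ '' Set.Iio 0))) ∧
    2 * Real.pi ^ 2 * (∫ x in Set.Iio 0, -(α x) / x)
        * (2 * (∫ t, χ t * deriv (deriv B) t) + ∫ t, deriv B t)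
      ≤ mongeAmpere puncturedBidisc (toricExt χ (sInf (χ '' Set.Iio 0)))
        (toricTest hα hα0 hB hB0 hB1) := by
  choose g c T hg hc h1 h2 h3 h4 using fun n : ℕ =>
    exists_smooth_convex_approx hneg hbdd hconv hmono hle (Nat.one_div_pos_of_nat (n := n))
  have hg2 : ∀ n, ContDiff ℝ 2 (g n) := fun n => (hg n).of_le (WithTop.coe_le_coe.2 le_top)
  have hw := fun n => contDiffOn_toricExt (hg2 n) (hc n)
  have hlim : Tendsto (fun n : ℕ => 1 / ((n : ℝ) + 1)) atTop (𝓝 0) :=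
    tendsto_one_div_add_atTop_nhds_zero_nat
  have hu : TendstoUniformlyOn (fun n => toricExt (g n) (c n))
      (toricExt χ (sInf (χ '' Set.Iio 0))) atTop puncturedBidisc := by
    rw [Metric.tendstoUniformlyOn_iff]
    intro ε hε
    filter_upwards [hlim.eventually_lt_const hε] with n hn p hp
    rw [dist_comm, Real.dist_eq]
    refine lt_of_le_of_lt ?_ hn
    by_cases h : p.1 = 0 ∨ p.2 = 0
    · rw [toricExt_of_axis h, toricExt_of_axis h]
      exact h4 n
    · rw [toricExt_of_ne h, toricExt_of_ne h]
      exact h3 n _ (blockiReal_neg (mem_toricBidisc hp h))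
  have hl := hasLeviMeasures_of_tendstoUniformlyOn hw
    (fun n => leviForm_toricExt_nonneg (hg2 n) (c n) (h1 n) (h2 n)) hu
  refine ⟨hl, ?_⟩
  have hMA := tendsto_mongeAmpere
    (hu.continuousOn (Frequently.of_forall fun n => (hw n).continuousOn))
    (fun n => (hw n).continuousOn) hu hl
    (fun n => hasLeviMeasures_toricExt (hg2 n) (hc n) (h1 n) (h2 n))
    (toricTest hα hα0 hB hB0 hB1)
  -- Both sides of the smooth inequality converge: the right one by continuity of the Monge-Ampère
  -- functional, the left one because $g$ enters only through $\int gB''$.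
  refine le_of_tendsto_of_tendsto' (Tendsto.const_mul _ (Tendsto.add_const _
    (Tendsto.const_mul 2 ?_))) hMA
    fun n => le_mongeAmpere_of_smooth hα hα0 hαI hB hB0 hB1 hBa (hg n) (hc n) (h1 n) (h2 n)
  refine tendsto_integral_mul_of_bounded hB.deriv_infty.deriv_infty.continuous
    (deriv_eq_zero_of_eqOn_const isClosed_Icc.isOpen_compl (deriv_eq_zero_of_notMem_Icc hB0 hB1))
    (fun n => (hg n).continuous.continuousOn) (fun n t ht => ?_) (fun t ht => ?_)
  · have ht0 : t < 0 := by linarith [ht.2]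
    have b1 := abs_le.1 ((h3 n t ht0).trans
      ((div_le_one (by positivity)).2 (by linarith [Nat.cast_nonneg (α := ℝ) n])))
    have b2 := hle t ht0
    have b3 : χ t < 0 := hneg ht0
    rw [abs_le]
    constructor <;> linarith [ht.1, b1.1, b1.2]
  · exact tendsto_iff_dist_tendsto_zero.2 (squeeze_zero (fun _ => dist_nonneg)
      (fun n => h3 n t (by linarith [ht.2])) hlim)

theorem integral_log_pos (hα : Continuous α) (hα0 : ∀ x, α x ≠ 0 → -3 < x ∧ x < -1)
    (hpos : ∀ x, 0 ≤ α x) {x₀ : ℝ} (hx₀ : α x₀ ≠ 0) : 0 < ∫ x in Set.Iio 0, -(α x) / x := by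
  have hsub : tsupport α ⊆ Set.Icc (-3) (-1) :=
    closure_minimal (fun x hx => ⟨(hα0 x hx).1.le, (hα0 x hx).2.le⟩) isClosed_Icc
  have hz : ∀ x, 0 ≤ x → α x = 0 := fun x hx => by
    by_contra h
    linarith [(hα0 x h).2]
  rw [setIntegral_Iio_eq_integral fun x hx => by rw [hz x hx, neg_zero, zero_div]]
  have e : ∀ x, -(α x) / x = -x⁻¹ * α x := fun x => by ring
  simp only [e]
  refine Continuous.integral_pos_of_hasCompactSupport_nonneg_nonzero (x := x₀)
    (continuous_mul_of_continuousOn isOpen_Iio (s := Set.Iio 0) (f := fun x => -x⁻¹)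
      (continuousOn_inv₀.mono fun x hx => ne_of_lt hx).neg hα
      fun x hx => lt_of_le_of_lt (hsub hx).2 (by norm_num))
    (isCompact_Icc.of_isClosed_subset (isClosed_tsupport _)
      (tsupport_mul_subset_right.trans hsub)) (fun x => ?_) ?_
  · rcases le_or_gt 0 x with hx | hx
    · simp [hz x hx]
    · exact mul_nonneg (by simpa using hx.le) (hpos x)
  · have : x₀ ≠ 0 := ((hα0 x₀ hx₀).2.trans (by norm_num)).ne
    exact mul_ne_zero (neg_ne_zero.2 (inv_ne_zero this)) hx₀

theorem integral_deriv_cutoff (hB : ContDiff ℝ ∞ B) (hB0 : ∀ t, -1 ≤ t → B t = 0)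
    (hB1 : ∀ t ≤ -2, B t = 1) : ∫ t, deriv B t = -1 := by
  rw [integral_of_hasDerivAt_of_tendsto (m := 1) (n := 0) hB.hasDerivAt_infty
    (integrable_of_continuousOn_Icc hB.deriv_infty.continuous.continuousOn
      (deriv_eq_zero_of_notMem_Icc hB0 hB1))]
  · norm_num
  · exact tendsto_const_nhds.congr' (by
      filter_upwards [eventually_le_atBot (-2 : ℝ)] with t ht using (hB1 t ht).symm)
  · exact tendsto_const_nhds.congr' (by
      filter_upwards [eventually_ge_atTop (-1 : ℝ)] with t ht using (hB0 t ht).symm)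

theorem integral_id_mul_deriv_deriv_cutoff (hB : ContDiff ℝ ∞ B) (hB0 : ∀ t, -1 ≤ t → B t = 0)
    (hB1 : ∀ t ≤ -2, B t = 1) : ∫ t, t * deriv (deriv B) t = 1 := by
  have h := integral_mul_deriv_eq_neg (f := fun t => t) contDiff_id hB.deriv_infty
    (deriv_eq_zero_of_notMem_Icc hB0 hB1)
  simp only [deriv_id'', one_mul, integral_deriv_cutoff hB hB0 hB1, neg_neg] at h
  exact h

end Main

theorem mainTheorem3 (χ : ℕ → ℝ → ℝ)
    (hneg : ∀ m, Set.MapsTo (χ m) (Set.Iio 0) (Set.Iio 0))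
    (hbdd : ∀ m, Bornology.IsBounded (χ m '' Set.Iio 0))
    (hconv : ∀ m, ConvexOn ℝ (Set.Iio 0) (χ m))
    (hmono : ∀ m, MonotoneOn (χ m) (Set.Iio 0))
    (hdecr : ∀ t < 0, Antitone (fun m => χ m t))
    (hlim : ∀ t < 0, Tendsto (fun m => χ m t) atTop (𝓝 t)) :
    (∀ m, HasLeviMeasures puncturedBidisc (fun p => extendBot (χ m) (blockiFun p))) ∧
    ¬ ∀ φ : 𝓓(puncturedBidisc, ℝ),
      Tendsto (fun m => mongeAmpere puncturedBidisc
        (fun p => extendBot (χ m) (blockiFun p)) φ) atTop (𝓝 0) := by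
  let α : ContDiffBump (-2 : ℝ) := ⟨1 / 2, 1, by norm_num, by norm_num⟩
  have hα : ContDiff ℝ ∞ α := α.contDiff
  have hα0 : ∀ x, α x ≠ 0 → -3 < x ∧ x < -1 := fun x hx => by
    have h : x ∈ Metric.ball (-2 : ℝ) 1 := by
      rw [← show α.rOut = 1 from rfl, ← α.support_eq]
      exact hx
    rw [Metric.mem_ball, Real.dist_eq, abs_lt] at h
    constructor <;> linarith [h.1, h.2]
  have hαI : 0 < ∫ x in Set.Iio 0, -(α x) / x :=
    integral_log_pos hα.continuous hα0 (fun x => α.nonneg) (x₀ := -2) (by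
      rw [α.one_of_mem_closedBall (Metric.mem_closedBall_self α.rIn_pos.le)]
      exact one_ne_zero)
  set B : ℝ → ℝ := fun t => Real.smoothTransition (-1 - t) with hBdef
  have hB : ContDiff ℝ ∞ B := Real.smoothTransition.contDiff.comp (contDiff_const.sub contDiff_id)
  have hB0 : ∀ t, -1 ≤ t → B t = 0 := fun t ht =>
    Real.smoothTransition.zero_of_nonpos (by linarith)
  have hB1 : ∀ t ≤ -2, B t = 1 := fun t ht => Real.smoothTransition.one_of_one_le (by linarith)
  have hBa : Antitone B := fun s t hst => Real.smoothTransition.monotone (by linarith)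
  -- A non-increasing sequence stays above its limit.
  have hle : ∀ m, ∀ t < 0, t ≤ χ m t := fun m t ht => (hdecr t ht).le_of_tendsto (hlim t ht) m
  have key := fun m => hasLeviMeasures_and_le_mongeAmpere hα hα0 hαI.le hB hB0 hB1 hBa (hneg m)
    (hbdd m) (hconv m) (hmono m) (hle m)
  simp only [extendBot_blockiFun]
  refine ⟨fun m => (key m).1, fun h => ?_⟩
  have hχ : Tendsto (fun m => ∫ t, χ m t * deriv (deriv B) t) atTop
      (𝓝 (∫ t, t * deriv (deriv B) t)) := by
    refine tendsto_integral_mul_of_bounded (f₀ := fun t => t)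
      hB.deriv_infty.deriv_infty.continuous
      (deriv_eq_zero_of_eqOn_const isClosed_Icc.isOpen_compl (deriv_eq_zero_of_notMem_Icc hB0 hB1))
      (fun m => ((hconv m).continuousOn isOpen_Iio).mono fun t ht => ?_)
      (fun m t ht => ?_) (fun t ht => hlim t (by linarith [ht.2]))
    · exact lt_of_le_of_lt ht.2 (by norm_num)
    · have ht0 : t < 0 := by linarith [ht.2]
      have b2 := hle m t ht0
      have b3 : χ m t < 0 := hneg m ht0
      rw [abs_le]
      constructor <;> linarith [ht.1]
  have hlow := ((hχ.const_mul 2).add_const (∫ t, deriv B t)).const_mul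
    (2 * Real.pi ^ 2 * ∫ x in Set.Iio 0, -(α x) / x)
  have hcontra := le_of_tendsto_of_tendsto' hlow (h (toricTest hα hα0 hB hB0 hB1))
    fun m => (key m).2
  -- The limiting factor is $2\cdot1+(-1)=1$, so convergence to $0$ would make a positive number at
  -- most $0$.
  rw [integral_deriv_cutoff hB hB0 hB1, integral_id_mul_deriv_deriv_cutoff hB hB0 hB1] at hcontra
  have : 0 < 2 * Real.pi ^ 2 * ∫ x in Set.Iio 0, -(α x) / x := by positivity
  linarith
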